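/- **Notation.** Let $n\ge 1$. A weight on $\mathbb R^{n+1}$ is a locally integrable function that is positive almost everywhere. A weight $\gamma$ belongs to $A_1^{\rm loc}(\mathbb R^{n+1})$ with constant $C_\gamma$ if $\frac1{|Q|}\iint_Q\gamma\,dx\,dt\le C_\gamma\operatorname{ess\,inf}_Q\gamma$ for every open cube $Q\subset\mathbb R^{n+1}$ (sides parallel to the axes) of side length at most $1$. Let $\mathbb R^{n+1}_+=\{(x,t):x\in\mathbb R^n,\ t>0\}$. The space $W^1_1(\mathbb R^{n+1}_+,\gamma)$ consists of the locally integrable functions $f$ on $\mathbb R^{n+1}_+$ with weak first-order partial derivatives and finite norm $$\|f|W^1_1(\mathbb R^{n+1}_+,\gamma)\|=\sum_{|\alpha|\le1}\|\gamma D^\alpha f|L_1(\mathbb R^{n+1}_+)\|.$$ A function $\varphi\in L_1^{\rm loc}(\mathbb R^n)$ is the trace of $f$ on $\mathbb R^n=\{t=0\}$ if, for a suitable representative of $f$, $\int_Q|\varphi(x)-f(x,t)|\,dx\to0$ as $t\to0+$ for every cube $Q\subset\mathbb R^n$. For $\alpha=(k,m)\in\mathbb Z_+\times\mathbb Z^n$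 let $Q_\alpha=Q_{k,m}=\prod_{i=1}^n\bigl(\frac{m_i}{2^k},\frac{m_i+1}{2^k}\bigr)$, $r(Q_\alpha)=2^{-k}$, and let $\widehat\gamma_\alpha$ be the mean value of $\gamma$ over $Q_\alpha\times(0,r(Q_\alpha))$. A tiling of $\mathbb R^n$ is a set $A\subset\mathbb Z_+\times\mathbb Z^n$ such that the cubes $Q_\alpha$, $\alpha\in A$, are pairwise disjoint and $\mathbb R^n=\bigcup_{\alpha\in A}\overline Q_\alpha$. A system of tilings is a sequence $(A^s)_{s\ge0}$ of tilings such that every $\overline Q_{\alpha'}$, $\alpha'\in A^{s+1}$, is contained in some $\overline Q_\alpha$, $\alpha\in A^s$. Fix $\lambda=1+2^{-k_0}$ with $k_0\in\mathbb Z_+$ and let $\widetilde Q_\alpha=\lambda Q_\alpha$ be the concentric enlarged open cube. For $c_1,c_2\ge1$ the system is admissible for $\gamma$ (with constants $c_1,c_2$) if, for all $s\ge0$: 1. $\widehat\gamma_\alpha\le c_1\widehat\gamma_{\alpha'}$ whenever $\alpha,\alpha'\in A^s$ and $\widetilde Q_\alpha\cap\widetilde Q_{\alpha'}\ne\varnothing$;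 2. $\widehat\gamma_\alpha\le c_2\widehat\gamma_{\alpha'}$ and $\widehat\gamma_{\alpha'}\le c_2\widehat\gamma_\alpha$ whenever $\alpha\in A^s$, $\alpha'\in A^{s+1}$ and $Q_{\alpha'}\subset Q_\alpha$; 3. $r(Q_{\alpha'})\le\frac12 r(Q_\alpha)$ whenever $\alpha\in A^s$, $\alpha'\in A^{s+1}$ and some point $x\in\mathbb R^n$ lies in both $\widetilde Q_\alpha$ and $\widetilde Q_{\alpha'}$; 4. $r(Q_\alpha)\ge2^{-l_s}$ for $\alpha\in A^s$, where $(l_j)_{j\ge0}$ is some strictly increasing sequence of nonnegative integers, the same for all $s$, with $l_0=0$. A reduced index set of a tiling $A$ is a set $\widetilde A\subset A$ such that $\mathbb R^n=\bigcup_{\alpha\in\widetilde A}\widetilde Q_\alpha$ and no $\widetilde Q_\alpha$, $\alpha\in\widetilde A$, is contained in $\bigcup_{\alpha'\in\widetilde A,\,\alpha'\ne\alpha}\widetilde Q_{\alpha'}$. **Theorem 4.1.** For every $n\ge1$ and $C_\gamma$ there are constants $c_1,c_2\ge1$, depending only on $n$ and $C_\gamma$, and for every $\lambda=1+2^{-k_0}$,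 $k_0\in\mathbb Z_+$, a constant $C=C(n,C_\gamma,\lambda,c_1,c_2)$, with the following property. Let $\gamma\in A_1^{\rm loc}(\mathbb R^{n+1})$ with constant $C_\gamma$ and let $f\in W^1_1(\mathbb R^{n+1}_+,\gamma)$. Then $f$ has a trace $\varphi$ on $\mathbb R^n$, and there is a system of tilings $(A^s)_{s\ge0}$ (depending on $f$) that is admissible for $\gamma$ with constants $c_1,c_2$, such that each $A^s$ has a reduced index set and, for every choice of reduced index sets $\widetilde A^s\subset A^s$, $$\sum_{m\in\mathbb Z^n}\widehat\gamma_{0,m}\|\varphi|L_1(Q_{0,m})\|+\sum_{s=1}^\infty\sum_{\alpha\in\widetilde A^s}\widehat\gamma_\alpha\int_{\widetilde Q_\alpha}|\varphi_\alpha-\varphi(x)|\,dx\le C\,\|f|W^1_1(\mathbb R^{n+1}_+,\gamma)\|,\qquad \varphi_\alpha=\frac1{|\widetilde Q_\alpha|}\int_{\widetilde Q_\alpha}\varphi(y)\,dy.$$ -/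

import Mathlib

open MeasureTheory Set Filter
open scoped Topology ENNReal

noncomputable section

/-- The space `ℝⁿ⁺¹ = ℝⁿ × ℝ`, with points `(x, t)` and Lebesgue (product) measure `volume`. -/
abbrev Space (n : ℕ) : Type := (Fin n → ℝ) × ℝ

/-- The open upper half-space `{(x, t) : t > 0}` of `ℝⁿ⁺¹`. -/
def upperHalf (n : ℕ) : Set (Space n) := {p | 0 < p.2}

/-- The open cube in `ℝⁿ` with sides parallel to the axes, lower corner `a` and side length `r`. -/
def cube {n : ℕ} (a : Fin n → ℝ) (r : ℝ) : Set (Fin n → ℝ) :=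
  {x | ∀ i, a i < x i ∧ x i < a i + r}

/-- The open cube in `ℝⁿ⁺¹` with lower corner `(a, b)` and side length `r`. -/
def spaceCube {n : ℕ} (a : Fin n → ℝ) (b r : ℝ) : Set (Space n) :=
  cube a r ×ˢ Ioo b (b + r)

/-! ### Weights -/

/-- A weight on `ℝⁿ⁺¹`: locally integrable and positive almost everywhere. -/
def IsWeight {n : ℕ} (γ : Space n → ℝ) : Prop :=
  LocallyIntegrable γ volume ∧ ∀ᵐ p ∂(volume : Measure (Space n)), 0 < γ p

/-- `γ ∈ A₁^loc(ℝⁿ⁺¹)` with constant `C`: on each cube of side length at most `1` the mean value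
of the weight `γ` is at most `C` times its essential infimum. -/
def IsA1Loc {n : ℕ} (γ : Space n → ℝ) (C : ℝ) : Prop :=
  IsWeight γ ∧ ∀ (a : Fin n → ℝ) (b r : ℝ), 0 < r → r ≤ 1 →
    (⨍ p in spaceCube a b r, γ p) ≤ C * essInf γ (volume.restrict (spaceCube a b r))

/-! ### Weighted Sobolev spaces -/

/-- `g` is a weak derivative of `f` on the open set `Ω` in the direction `v`. -/
def HasWeakDeriv {n : ℕ} (Ω : Set (Space n)) (v : Space n) (f g : Space n → ℝ) : Prop :=
  LocallyIntegrableOn g Ω volume ∧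
    ∀ ψ : Space n → ℝ, ContDiff ℝ (⊤ : ℕ∞) ψ → HasCompactSupport ψ → tsupport ψ ⊆ Ω →
      ∫ p in Ω, f p * fderiv ℝ ψ p v = - ∫ p in Ω, g p * ψ p

open Classical in
/-- The weak derivative of `f` on `Ω` in the direction `v` (unique almost everywhere on `Ω`);
by convention `0` if there is none. -/
def weakDeriv {n : ℕ} (Ω : Set (Space n)) (v : Space n) (f : Space n → ℝ) : Space n → ℝ :=
  if h : ∃ g, HasWeakDeriv Ω v f g then h.choose else 0

/-- The coordinate direction of the variable `x i`. -/
def dirX {n : ℕ} (i : Fin n) : Space n := (Pi.single i 1, 0)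

/-- The coordinate direction of the variable `t`. -/
def dirT (n : ℕ) : Space n := (0, 1)

/-- The norm of `W¹₁(Ω, γ)`: the sum of the `L₁(Ω)` norms of `γ f` and of `γ D f`, where `D f`
runs through the `n + 1` first order weak partial derivatives of `f`. -/
def sobolevNorm {n : ℕ} (Ω : Set (Space n)) (γ f : Space n → ℝ) : ℝ≥0∞ :=
  (∫⁻ p in Ω, ‖γ p * f p‖ₑ)
    + (∑ i : Fin n, ∫⁻ p in Ω, ‖γ p * weakDeriv Ω (dirX i) f p‖ₑ)
    + ∫⁻ p in Ω, ‖γ p * weakDeriv Ω (dirT n) f p‖ₑ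

/-- Membership in `W¹₁(Ω, γ)`. -/
structure MemSobolev {n : ℕ} (Ω : Set (Space n)) (γ f : Space n → ℝ) : Prop where
  locallyIntegrable : LocallyIntegrableOn f Ω volume
  exists_derivX : ∀ i : Fin n, ∃ g, HasWeakDeriv Ω (dirX i) f g
  exists_derivT : ∃ g, HasWeakDeriv Ω (dirT n) f g
  norm_lt_top : sobolevNorm Ω γ f < ∞

/-- `φ` is the trace on `ℝⁿ = {t = 0}` of the function `f` on the upper half-space: for a
suitable representative `g` of the almost everywhere class of `f`, the functions `g(·, t)`
converge to `φ` in `L₁(Q)` as `t → 0+`, for every cube `Q` of `ℝⁿ`. -/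
def IsTrace {n : ℕ} (f : Space n → ℝ) (φ : (Fin n → ℝ) → ℝ) : Prop :=
  LocallyIntegrable φ volume ∧
    ∃ g : Space n → ℝ, g =ᵐ[volume.restrict (upperHalf n)] f ∧
      ∀ (a : Fin n → ℝ) (r : ℝ), 0 < r →
        Tendsto (fun t : ℝ => ∫⁻ x in cube a r, ‖φ x - g (x, t)‖ₑ) (𝓝[>] 0) (𝓝 0)

/-! ### Dyadic cubes and tilings -/

/-- Indices `(k, m) ∈ ℤ₊ × ℤⁿ` of the dyadic cubes `Q_{k,m}`. -/
abbrev DyadicIndex (n : ℕ) : Type := ℕ × (Fin n → ℤ)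

/-- The side length `2^{-k}` of `Q_{k,m}`. -/
def side {n : ℕ} (α : DyadicIndex n) : ℝ := ((2 : ℝ) ^ α.1)⁻¹

/-- The open dyadic cube `Q_{k,m} = ∏ (m_i / 2^k, (m_i + 1) / 2^k)`. -/
def dyadicCube {n : ℕ} (α : DyadicIndex n) : Set (Fin n → ℝ) :=
  {x | ∀ i, (α.2 i : ℝ) / 2 ^ α.1 < x i ∧ x i < ((α.2 i : ℝ) + 1) / 2 ^ α.1}

/-- The closed dyadic cube `∏ [m_i / 2^k, (m_i + 1) / 2^k]`. -/
def closedDyadicCube {n : ℕ} (α : DyadicIndex n) : Set (Fin n → ℝ) :=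
  {x | ∀ i, (α.2 i : ℝ) / 2 ^ α.1 ≤ x i ∧ x i ≤ ((α.2 i : ℝ) + 1) / 2 ^ α.1}

/-- The enlarged open cube `(1 + 2^{-j}) Q_{k,m}`, concentric with `Q_{k,m}`. -/
def enlargedCube {n : ℕ} (j : ℕ) (α : DyadicIndex n) : Set (Fin n → ℝ) :=
  {x | ∀ i, |x i - ((α.2 i : ℝ) + 1 / 2) / 2 ^ α.1| < (1 + ((2 : ℝ) ^ j)⁻¹) * side α / 2}

/-- The mean value of `γ` over `Q_{k,m} × (0, 2^{-k})`. -/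
def meanWeight {n : ℕ} (γ : Space n → ℝ) (α : DyadicIndex n) : ℝ :=
  ⨍ p in dyadicCube α ×ˢ Ioo 0 (side α), γ p

/-- The closed dyadic cubes with indices in `A` form a tiling of `ℝⁿ`. -/
structure IsTiling {n : ℕ} (A : Set (DyadicIndex n)) : Prop where
  disjoint : ∀ α ∈ A, ∀ β ∈ A, α ≠ β → Disjoint (dyadicCube α) (dyadicCube β)
  cover : ⋃ α ∈ A, closedDyadicCube α = univ

/-- The tiling `A'` succeeds the tiling `A`. -/
def Succeeds {n : ℕ} (A' A : Set (DyadicIndex n)) : Prop :=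
  ∀ α' ∈ A', ∃ α ∈ A, closedDyadicCube α' ⊆ closedDyadicCube α

/-- A system of tilings of `ℝⁿ`. -/
structure IsTilingSystem {n : ℕ} (A : ℕ → Set (DyadicIndex n)) : Prop where
  tiling : ∀ s, IsTiling (A s)
  succ : ∀ s, Succeeds (A (s + 1)) (A s)

/-- The system of tilings `A` is admissible for the weight `γ`, with constants `c₁`, `c₂`; cubes
are enlarged by the factor `1 + 2^{-j}`. -/
structure IsAdmissible {n : ℕ} (γ : Space n → ℝ) (j : ℕ) (c₁ c₂ : ℝ)
    (A : ℕ → Set (DyadicIndex n)) : Prop where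
  system : IsTilingSystem A
  neighbours : ∀ s, ∀ α ∈ A s, ∀ α' ∈ A s,
    (enlargedCube j α ∩ enlargedCube j α').Nonempty → meanWeight γ α ≤ c₁ * meanWeight γ α'
  nested : ∀ s, ∀ α ∈ A s, ∀ α' ∈ A (s + 1), dyadicCube α' ⊆ dyadicCube α →
    meanWeight γ α ≤ c₂ * meanWeight γ α' ∧ meanWeight γ α' ≤ c₂ * meanWeight γ α
  halving : ∀ s, ∀ x, ∀ α ∈ A s, ∀ α' ∈ A (s + 1),
    x ∈ enlargedCube j α → x ∈ enlargedCube j α' → side α' ≤ side α / 2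
  size : ∃ l : ℕ → ℕ, StrictMono l ∧ l 0 = 0 ∧
    ∀ s, ∀ α ∈ A s, ((2 : ℝ) ^ l s)⁻¹ ≤ side α

/-- `B` is a reduced index set of the tiling `A`: the enlarged cubes with indices in `B ⊆ A` cover
`ℝⁿ`, and none of them is contained in the union of the others. -/
structure IsReducedIndexSet {n : ℕ} (j : ℕ) (A B : Set (DyadicIndex n)) : Prop where
  subset : B ⊆ A
  cover : ⋃ α ∈ B, enlargedCube j α = univ
  irredundant : ∀ α ∈ B, ¬ enlargedCube j α ⊆ ⋃ β ∈ B \ {α}, enlargedCube j β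

/-- `∑_m γ̂_{0,m} ‖φ | L₁(Q_{0,m})‖`. -/
def unitCubeSum {n : ℕ} (γ : Space n → ℝ) (φ : (Fin n → ℝ) → ℝ) : ℝ≥0∞ :=
  ∑' m : Fin n → ℤ, ENNReal.ofReal (meanWeight γ (0, m)) * ∫⁻ x in dyadicCube (0, m), ‖φ x‖ₑ

/-- `∑_{s ≥ 1} ∑_{α ∈ B s} γ̂_α ∫_{Q̃_α} |φ_α - φ|`, where `Q̃_α` is the enlarged cube and `φ_α` the
mean value of `φ` over it. -/
def oscillationSum {n : ℕ} (γ : Space n → ℝ) (j : ℕ) (B : ℕ → Set (DyadicIndex n))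
    (φ : (Fin n → ℝ) → ℝ) : ℝ≥0∞ :=
  ∑' s : ℕ, ∑' α : B (s + 1), ENNReal.ofReal (meanWeight γ α) *
    ∫⁻ x in enlargedCube j (α : DyadicIndex n),
      ‖(⨍ y in enlargedCube j (α : DyadicIndex n), φ y) - φ x‖ₑ

end

/-! Write `w α` for the mean of `γ` over the box of height `side α` above `Q_α`. The A₁ condition
makes `w` slowly varying (`IsA1Loc.isSlowlyVarying`): up to one factor `D`, it cannot decrease on
passing to a smaller cube, cannot jump from a cube to its child, and agrees on adjacent cubes. It
also bounds `w α` by `D * γ p` for almost every `p` in the box over the enlarged cube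
(`IsA1Loc.ae_meanWeight_le`).

A Poincaré argument on horizontal slices, together with integration of the `t`-derivative down to
the boundary, bounds the oscillation of the trace on an enlarged cube by the integral of the
gradient over the box above it (`IsTrace.lintegral_average_sub_le`). The oscillation sum is
therefore at most a constant times the integral of `W * |∇f|`, where `W p` is the total weight of
the boxes containing `p`. In general `W` is not bounded by a multiple of `γ`, since a point close to
the boundary can lie in boxes of many tilings. The tilings are chosen so that this repetition is
harmless.

The levels `l s` are chosen so that the weighted gradient has mass at most `2⁻¹ ^ s` times its total
in the strip of height `2^{-l s}` (`exists_levels`). The `s`-th tiling consists of the maximal cubes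
that either have reached level `l s` or have grown in weight by `T ^ (s - i)` since some earlier
level `l i`. Cubes stopped by size have their boxes inside the strip, so they contribute a
convergent geometric series. For a cube stopped by growth, `w` is at least twice its value on any
overlapping cube of an earlier tiling (`IsSlowlyVarying.two_mul_le`). At a fixed point these weights
form a geometric progression, whose sum is controlled by its largest term and hence by `D * γ p`.
Within one tiling, irredundancy of the reduced index set bounds the overlap
(`card_le_overlapBound`).

Admissibility comes from the same stopping rule. Once `T` dominates `D ^ 3`, consecutive tilings
strictly refine each other even across overlapping enlarged cubes. Before stopping, the growth from
every reference level is under control, which makes neighbouring and nested cubes comparable. -/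

/-! ### Dyadic indices: ancestors and adjacency -/

/-- The index of the dyadic cube of level `j` containing the cube `Q_α` (for `j ≤ α.1`). -/
def ancestor {n : ℕ} (j : ℕ) (α : DyadicIndex n) : DyadicIndex n :=
  (j, fun i => α.2 i / 2 ^ (α.1 - j))

/-- Two dyadic cubes of the same level are adjacent if their closures meet. -/
def Adjacent {n : ℕ} (α β : DyadicIndex n) : Prop :=
  α.1 = β.1 ∧ ∀ i, |α.2 i - β.2 i| ≤ 1

section Dyadic

variable {n : ℕ}

@[simp] theorem ancestor_fst (j : ℕ) (α : DyadicIndex n) : (ancestor j α).1 = j := rfl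

@[simp] theorem ancestor_self (α : DyadicIndex n) : ancestor α.1 α = α := by
  ext <;> simp [ancestor]

theorem ancestor_ancestor {i j : ℕ} {α : DyadicIndex n} (hij : i ≤ j) (hj : j ≤ α.1) :
    ancestor i (ancestor j α) = ancestor i α := by
  refine Prod.ext rfl (funext fun a => ?_)
  simp only [ancestor]
  rw [Int.ediv_ediv_of_nonneg (by positivity), ← pow_add]
  congr 2
  omega

theorem Adjacent.symm {α β : DyadicIndex n} (h : Adjacent α β) : Adjacent β α :=
  ⟨h.1.symm, fun i => by rw [abs_sub_comm]; exact h.2 i⟩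

theorem Adjacent.ancestor {α β : DyadicIndex n} (h : Adjacent α β) (j : ℕ) :
    Adjacent (ancestor j α) (ancestor j β) := by
  have key : ∀ (a b : ℤ) (d : ℕ), a ≤ b + 1 → a / 2 ^ d ≤ b / 2 ^ d + 1 := by
    intro a b d hab
    have hd : (0 : ℤ) < 2 ^ d := by positivity
    calc a / 2 ^ d ≤ (b + 2 ^ d * 1) / 2 ^ d := Int.ediv_le_ediv hd (by linarith)
      _ = b / 2 ^ d + 1 := Int.add_mul_ediv_left _ _ hd.ne'
  refine ⟨rfl, fun i => ?_⟩
  have hi := abs_le.1 (h.2 i)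
  simp only [_root_.ancestor, h.1]
  rw [abs_le]
  constructor
  · linarith [key (β.2 i) (α.2 i) (β.1 - j) (by linarith)]
  · linarith [key (α.2 i) (β.2 i) (β.1 - j) (by linarith)]

theorem side_pos (α : DyadicIndex n) : 0 < side α := by
  unfold side; positivity

theorem side_le_one (α : DyadicIndex n) : side α ≤ 1 := by
  unfold side; exact inv_le_one_of_one_le₀ (one_le_pow₀ (by norm_num))

theorem mem_dyadicCube_iff {α : DyadicIndex n} {x : Fin n → ℝ} :
    x ∈ dyadicCube α ↔ ∀ i, (α.2 i : ℝ) < x i * 2 ^ α.1 ∧ x i * 2 ^ α.1 < α.2 i + 1 := by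
  have : (0 : ℝ) < 2 ^ α.1 := by positivity
  simp only [dyadicCube, mem_ofPred_eq, div_lt_iff₀ this, lt_div_iff₀ this]

theorem mem_closedDyadicCube_iff {α : DyadicIndex n} {x : Fin n → ℝ} :
    x ∈ closedDyadicCube α ↔ ∀ i, (α.2 i : ℝ) ≤ x i * 2 ^ α.1 ∧ x i * 2 ^ α.1 ≤ α.2 i + 1 := by
  have : (0 : ℝ) < 2 ^ α.1 := by positivity
  simp only [closedDyadicCube, mem_ofPred_eq, div_le_iff₀ this, le_div_iff₀ this]

theorem mem_enlargedCube_iff {k : ℕ} {α : DyadicIndex n} {x : Fin n → ℝ} :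
    x ∈ enlargedCube k α ↔
      ∀ i, |x i * 2 ^ α.1 - (α.2 i + 1 / 2)| < (1 + ((2 : ℝ) ^ k)⁻¹) / 2 := by
  have h : (0 : ℝ) < 2 ^ α.1 := by positivity
  simp only [enlargedCube, mem_ofPred_eq, side]
  refine forall_congr' fun i => ?_
  rw [← mul_lt_mul_iff_left₀ h, ← abs_of_pos h, ← abs_mul, abs_of_pos h, sub_mul,
    div_mul_cancel₀ _ h.ne', div_mul_eq_mul_div, mul_assoc _ _ ((2 : ℝ) ^ α.1),
    inv_mul_cancel₀ h.ne', mul_one]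

theorem ancestor_coord_bounds {j : ℕ} {α : DyadicIndex n} (i : Fin n) :
    (((ancestor j α).2 i : ℤ) : ℝ) * 2 ^ (α.1 - j) ≤ α.2 i ∧
      (α.2 i : ℝ) + 1 ≤ (((ancestor j α).2 i : ℝ) + 1) * 2 ^ (α.1 - j) := by
  have hd : (0 : ℤ) < 2 ^ (α.1 - j) := by positivity
  constructor
  · have := Int.ediv_mul_le (α.2 i) hd.ne'
    exact_mod_cast this
  · have := Int.lt_ediv_add_one_mul_self (α.2 i) hd
    exact_mod_cast this

theorem pow_level_eq {j : ℕ} {α : DyadicIndex n} (hj : j ≤ α.1) :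
    (2 : ℝ) ^ α.1 = 2 ^ j * 2 ^ (α.1 - j) := by
  rw [← pow_add]; congr 1; omega

theorem dyadicCube_subset_ancestor {j : ℕ} {α : DyadicIndex n} (hj : j ≤ α.1) :
    dyadicCube α ⊆ dyadicCube (ancestor j α) := by
  intro x hx
  rw [mem_dyadicCube_iff] at hx ⊢
  intro i
  obtain ⟨h1, h2⟩ := hx i
  obtain ⟨h3, h4⟩ := ancestor_coord_bounds (j := j) (α := α) i
  rw [pow_level_eq hj, ← mul_assoc] at h1 h2
  have hd : (0 : ℝ) < 2 ^ (α.1 - j) := by positivity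
  exact ⟨lt_of_mul_lt_mul_right (h3.trans_lt h1) hd.le,
    lt_of_mul_lt_mul_right (h2.trans_le h4) hd.le⟩

theorem closedDyadicCube_subset_ancestor {j : ℕ} {α : DyadicIndex n} (hj : j ≤ α.1) :
    closedDyadicCube α ⊆ closedDyadicCube (ancestor j α) := by
  intro x hx
  rw [mem_closedDyadicCube_iff] at hx ⊢
  intro i
  obtain ⟨h1, h2⟩ := hx i
  obtain ⟨h3, h4⟩ := ancestor_coord_bounds (j := j) (α := α) i
  rw [pow_level_eq hj, ← mul_assoc] at h1 h2
  have hd : (0 : ℝ) < 2 ^ (α.1 - j) := by positivity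
  exact ⟨le_of_mul_le_mul_right (h3.trans h1) hd, le_of_mul_le_mul_right (h2.trans h4) hd⟩

theorem dyadicCube_nonempty (α : DyadicIndex n) : (dyadicCube α).Nonempty := by
  refine ⟨fun i => (α.2 i + 1 / 2) / 2 ^ α.1, mem_dyadicCube_iff.2 fun i => ?_⟩
  rw [div_mul_cancel₀ _ (by positivity)]
  constructor <;> linarith

theorem closedDyadicCube_subset_enlargedCube (k : ℕ) (α : DyadicIndex n) :
    closedDyadicCube α ⊆ enlargedCube k α := by
  intro x hx
  rw [mem_closedDyadicCube_iff] at hx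
  rw [mem_enlargedCube_iff]
  intro i
  have : (0 : ℝ) < (2 ^ k)⁻¹ := by positivity
  rw [abs_lt]
  constructor <;> linarith [(hx i).1, (hx i).2]

theorem dyadicCube_subset_enlargedCube (k : ℕ) (α : DyadicIndex n) :
    dyadicCube α ⊆ enlargedCube k α := fun _ hx =>
  closedDyadicCube_subset_enlargedCube k α fun i => ⟨(hx i).1.le, (hx i).2.le⟩

theorem ancestor_eq_of_inter {α β : DyadicIndex n} (h : (dyadicCube α ∩ dyadicCube β).Nonempty)
    (hl : α.1 ≤ β.1) : ancestor α.1 β = α := by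
  obtain ⟨x, hα, hβ⟩ := h
  rw [mem_dyadicCube_iff] at hα hβ
  refine Prod.ext rfl (funext fun i => ?_)
  have hd : (0 : ℤ) < 2 ^ (β.1 - α.1) := by positivity
  have hd' : (0 : ℝ) < 2 ^ (β.1 - α.1) := by positivity
  obtain ⟨h1, h2⟩ := hα i
  obtain ⟨h3, h4⟩ := hβ i
  rw [pow_level_eq hl, ← mul_assoc] at h3 h4
  have h5 := (mul_lt_mul_of_pos_right h1 hd').trans h4
  have h6 := h3.trans (mul_lt_mul_of_pos_right h2 hd')
  have h7 : α.2 i * 2 ^ (β.1 - α.1) < β.2 i + 1 := by exact_mod_cast h5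
  have h8 : β.2 i < (α.2 i + 1) * 2 ^ (β.1 - α.1) := by exact_mod_cast h6
  exact le_antisymm (Int.lt_add_one_iff.1 (Int.ediv_lt_of_lt_mul hd h8))
    (Int.le_ediv_of_mul_le hd (Int.lt_add_one_iff.1 h7))

theorem half_enlargement_le (k : ℕ) : (1 + ((2 : ℝ) ^ k)⁻¹) / 2 ≤ 1 := by
  have : ((2 : ℝ) ^ k)⁻¹ ≤ 1 := inv_le_one_of_one_le₀ (one_le_pow₀ (by norm_num))
  linarith

/-- The enlargement factor is at most 2, so each cube is extended by at most half its own side, and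
for `β` this is no more than half the side of `α`. In units of `side α` the corners of `α` and of
the ancestor of `β` differ by integers of modulus less than 2. -/
theorem adjacent_ancestor_of_inter {k : ℕ} {α β : DyadicIndex n}
    (h : (enlargedCube k α ∩ enlargedCube k β).Nonempty) (hl : α.1 ≤ β.1) :
    Adjacent α (ancestor α.1 β) := by
  obtain ⟨x, hα, hβ⟩ := h
  rw [mem_enlargedCube_iff] at hα hβ
  refine ⟨rfl, fun i => ?_⟩
  have hd : (1 : ℝ) ≤ 2 ^ (β.1 - α.1) := one_le_pow₀ (by norm_num)
  obtain ⟨h1, h2⟩ := abs_lt.1 ((hα i).trans_le (half_enlargement_le k))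
  obtain ⟨h3, h4⟩ := abs_lt.1 ((hβ i).trans_le (half_enlargement_le k))
  obtain ⟨h5, h6⟩ := ancestor_coord_bounds (j := α.1) (α := β) i
  rw [pow_level_eq hl, ← mul_assoc] at h3 h4
  set d : ℝ := 2 ^ (β.1 - α.1)
  set y : ℝ := x i * 2 ^ α.1
  set m := (ancestor α.1 β).2 i
  have h7 : (m : ℝ) < α.2 i + 2 := by
    by_contra! hc
    nlinarith [mul_le_mul_of_nonneg_right hc (by linarith : (0 : ℝ) ≤ d),
      mul_lt_mul_of_pos_right h2 (by linarith : (0 : ℝ) < d)]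
  have h8 : (α.2 i : ℝ) < m + 2 := by
    by_contra! hc
    nlinarith [mul_le_mul_of_nonneg_right hc (by linarith : (0 : ℝ) ≤ d),
      mul_lt_mul_of_pos_right h1 (by linarith : (0 : ℝ) < d)]
  have h9 : m < α.2 i + 2 := by exact_mod_cast h7
  have h10 : α.2 i < m + 2 := by exact_mod_cast h8
  rw [abs_le]
  constructor <;> linarith

theorem exists_index_mem_closedDyadicCube (k : ℕ) (x : Fin n → ℝ) :
    ∃ α : DyadicIndex n, α.1 = k ∧ x ∈ closedDyadicCube α :=
  ⟨(k, fun i => ⌊x i * 2 ^ k⌋), rfl, mem_closedDyadicCube_iff.2 fun _ =>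
    ⟨Int.floor_le _, (Int.lt_floor_add_one _).le⟩⟩

/-- The maximal elements of a set of dyadic indices. -/
def maximalIndices (E : Set (DyadicIndex n)) : Set (DyadicIndex n) :=
  {α | α ∈ E ∧ ∀ j < α.1, ancestor j α ∉ E}

theorem exists_maximal_ancestor {E : Set (DyadicIndex n)} {α : DyadicIndex n} (h : α ∈ E) :
    ∃ j ≤ α.1, ancestor j α ∈ maximalIndices E := by
  classical
  have hex : ∃ j, j ≤ α.1 ∧ ancestor j α ∈ E := ⟨α.1, le_rfl, by simpa⟩
  refine ⟨Nat.find hex, (Nat.find_spec hex).1, (Nat.find_spec hex).2, fun j hj hE => ?_⟩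
  rw [ancestor_fst] at hj
  rw [ancestor_ancestor hj.le (Nat.find_spec hex).1] at hE
  exact Nat.find_min hex hj ⟨hj.le.trans (Nat.find_spec hex).1, hE⟩

/-- Dyadic cubes are nested or disjoint, so two overlapping maximal cubes coincide. Every point lies
in a closed cube of level `l`, which belongs to `E` and so has a maximal ancestor. -/
theorem isTiling_maximalIndices {E : Set (DyadicIndex n)} {l : ℕ}
    (hE : ∀ α : DyadicIndex n, l ≤ α.1 → α ∈ E) : IsTiling (maximalIndices E) where
  disjoint α hα β hβ hne := by
    rw [Set.disjoint_iff_inter_eq_empty, ← Set.not_nonempty_iff_eq_empty]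
    intro h
    wlog hl : α.1 ≤ β.1 generalizing α β
    · exact this β hβ α hα hne.symm (by rwa [inter_comm]) (not_le.1 hl).le
    have h1 := ancestor_eq_of_inter h hl
    rcases hl.lt_or_eq with hl | hl
    · exact hβ.2 _ hl (h1 ▸ hα.1)
    · rw [hl, ancestor_self] at h1
      exact hne h1.symm
  cover := by
    refine eq_univ_of_forall fun x => ?_
    obtain ⟨α, hα, hx⟩ := exists_index_mem_closedDyadicCube l x
    obtain ⟨j, hj, hjm⟩ := exists_maximal_ancestor (hE α hα.ge)
    exact mem_biUnion hjm (closedDyadicCube_subset_ancestor hj hx)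

theorem succeeds_maximalIndices {E E' : Set (DyadicIndex n)} (h : E' ⊆ E) :
    Succeeds (maximalIndices E') (maximalIndices E) := by
  intro α hα
  obtain ⟨j, hj, hjm⟩ := exists_maximal_ancestor (h hα.1)
  exact ⟨_, hjm, closedDyadicCube_subset_ancestor hj⟩

end Dyadic

/-! ### The stopping time construction -/

/-- A positive function of dyadic indices that is, up to the factor `D`, increasing towards smaller
cubes, doubling, and comparable on adjacent cubes. -/
structure IsSlowlyVarying {n : ℕ} (w : DyadicIndex n → ℝ) (D : ℝ) : Prop where
  one_le : 1 ≤ D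
  pos : ∀ α, 0 < w α
  ancestor_le : ∀ α, ∀ j ≤ α.1, w (ancestor j α) ≤ D * w α
  le_parent : ∀ α, ∀ j, α.1 = j + 1 → w α ≤ D * w (ancestor j α)
  le_adjacent : ∀ α β, Adjacent α β → w α ≤ D * w β

/-- The cubes at which the `s`-th tiling may stop: those of level at least `l s`, and those on which
`w` has grown by the factor `T ^ (s - i)` since the level `l i`, for some `i < s`. -/
def stoppingSet {n : ℕ} (w : DyadicIndex n → ℝ) (T : ℝ) (l : ℕ → ℕ) (s : ℕ) :
    Set (DyadicIndex n) :=
  {α | l s ≤ α.1 ∨ ∃ i < s, l i ≤ α.1 ∧ T ^ (s - i) * w (ancestor (l i) α) ≤ w α}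

/-- The tiling by the maximal cubes of the stopping set. -/
def stoppingTiling {n : ℕ} (w : DyadicIndex n → ℝ) (T : ℝ) (l : ℕ → ℕ) (s : ℕ) :
    Set (DyadicIndex n) :=
  maximalIndices (stoppingSet w T l s)

section Stopping

variable {n : ℕ} {w : DyadicIndex n → ℝ} {D T : ℝ} {l : ℕ → ℕ} {k : ℕ}

/-- Growth by `T ^ (s + 1 - i)` implies growth by `T ^ (s - i)`. For `i = s` the cube already has
level at least `l s`. -/
theorem stoppingSet_succ_subset (hw : ∀ α, 0 < w α) (hT : 1 ≤ T) (hl : StrictMono l) (s : ℕ) :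
    stoppingSet w T l (s + 1) ⊆ stoppingSet w T l s := by
  rintro α (h | ⟨i, hi, hil, h⟩)
  · exact Or.inl ((hl s.lt_succ_self).le.trans h)
  · rcases (Nat.lt_succ_iff.1 hi).eq_or_lt with rfl | his
    · exact Or.inl hil
    · refine Or.inr ⟨i, his, hil, le_trans ?_ h⟩
      exact mul_le_mul_of_nonneg_right (pow_le_pow_right₀ hT (by omega)) (hw _).le

theorem stoppingSet_antitone (hw : ∀ α, 0 < w α) (hT : 1 ≤ T) (hl : StrictMono l) :
    Antitone (stoppingSet w T l) :=
  antitone_nat_of_succ_le (stoppingSet_succ_subset hw hT hl)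

theorem level_le_of_mem_stoppingTiling {s : ℕ} {α : DyadicIndex n}
    (h : α ∈ stoppingTiling w T l s) : α.1 ≤ l s := by
  by_contra! hlt
  exact h.2 _ hlt (Or.inl le_rfl)

/-- Growth has occurred on a stopped cube larger than the smallest admitted ones. -/
theorem exists_growth {s : ℕ} {α : DyadicIndex n} (h : α ∈ stoppingSet w T l s)
    (hα : α.1 < l s) :
    ∃ i < s, l i ≤ α.1 ∧ T ^ (s - i) * w (ancestor (l i) α) ≤ w α :=
  h.resolve_left (not_le.2 hα)

/-- Until stopping the growth is controlled. -/
theorem IsSlowlyVarying.le_of_mem_stoppingTiling (hw : IsSlowlyVarying w D) {s : ℕ}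
    {α : DyadicIndex n} (h : α ∈ stoppingTiling w T l s) {i : ℕ} (hi : i < s)
    (hil : l i < α.1) : w α ≤ D * (T ^ (s - i) * w (ancestor (l i) α)) := by
  -- The parent still has level at least `l i` but is not in the stopping set, by maximality. Its
  -- growth is thus below `T ^ (s - i)`, and the last step down costs one factor `D`.
  obtain ⟨j, hj⟩ : ∃ j, α.1 = j + 1 := ⟨α.1 - 1, by omega⟩
  have hD : 0 < D := one_pos.trans_le hw.one_le
  refine (hw.le_parent α j hj).trans (mul_le_mul_of_nonneg_left ?_ hD.le)
  by_contra! hlt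
  refine h.2 j (by omega) (Or.inr ⟨i, hi, ?_, ?_⟩)
  · rw [ancestor_fst]; omega
  · rw [ancestor_ancestor (by omega) (by omega)]; exact hlt.le

/-- If `β` were at least as large as `α`, it would have been stopped by growth. The same growth,
with one factor `T` fewer, would then already be visible on the ancestor of `α` one level above `β`,
against the maximality of `α`. This gives the halving condition. -/
theorem IsSlowlyVarying.level_lt (hw : IsSlowlyVarying w D) (hT : D ^ 3 < T)
    (hl : StrictMono l) {s : ℕ} {α β : DyadicIndex n} (hα : α ∈ stoppingTiling w T l s)
    (hβ : β ∈ stoppingSet w T l (s + 1))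
    (h : (enlargedCube k α ∩ enlargedCube k β).Nonempty) : α.1 < β.1 := by
  by_contra! hle
  have hD := hw.one_le
  have hD0 : 0 < D := one_pos.trans_le hD
  have hT1 : 1 < T := (one_le_pow₀ hD).trans_lt hT
  have hadj := adjacent_ancestor_of_inter (by rwa [inter_comm]) hle
  have hlev := level_le_of_mem_stoppingTiling hα
  obtain ⟨i, hi, hil, hg⟩ := exists_growth hβ (hle.trans_lt (hlev.trans_lt (hl s.lt_succ_self)))
  -- At the reference level itself, `β` would have to exceed its own weight by a positive power of
  -- `T > 1`.
  rcases hil.eq_or_lt with heq | hlt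
  · rw [heq, ancestor_self] at hg
    have := one_lt_pow₀ hT1 (by omega : s + 1 - i ≠ 0)
    nlinarith [hw.pos β]
  · obtain ⟨j, hj⟩ : ∃ j, β.1 = j + 1 := ⟨β.1 - 1, by omega⟩
    refine hα.2 j (by omega) ?_
    have hadj' := hadj.ancestor (l i)
    rw [ancestor_ancestor hlt.le hle] at hadj'
    have h1 := hw.le_adjacent _ _ hadj
    have h2 := hw.le_adjacent _ _ hadj'.symm
    have h3 := hw.le_parent (ancestor β.1 α) j hj
    rw [ancestor_ancestor (by omega) hle] at h3
    rcases (Nat.lt_succ_iff.1 hi).eq_or_lt with rfl | his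
    · exact Or.inl (by rw [ancestor_fst]; omega)
    · refine Or.inr ⟨i, his, by rw [ancestor_fst]; omega, ?_⟩
      rw [ancestor_ancestor (by omega) (by omega)]
      have e : T ^ (s + 1 - i) = T ^ (s - i) * T := by
        rw [← pow_succ]; congr 1; omega
      have hp : 0 < T ^ (s - i) := by positivity
      -- The three factors `D` pay for adjacency at level `l i`, adjacency at level `β.1`, and the
      -- passage to the parent.
      have h4 : T ^ (s - i) * w (ancestor (l i) α) * D ^ 3
          ≤ w (ancestor j α) * D ^ 3 := by
        calc T ^ (s - i) * w (ancestor (l i) α) * D ^ 3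
            ≤ T ^ (s - i) * (D * w (ancestor (l i) β)) * D ^ 3 := by gcongr
          _ = D * (T ^ (s - i) * D ^ 3 * w (ancestor (l i) β)) := by ring
          _ ≤ D * (T ^ (s - i) * T * w (ancestor (l i) β)) := by
              have := (hw.pos (ancestor (l i) β)).le
              gcongr
          _ ≤ D * w β := by rw [← e]; gcongr
          _ ≤ D * (D * w (ancestor β.1 α)) := by gcongr
          _ ≤ D * (D * (D * w (ancestor j α))) := by gcongr
          _ = _ := by ring
      exact le_of_mul_le_mul_right h4 (by positivity)

theorem IsSlowlyVarying.level_lt_of_lt (hw : IsSlowlyVarying w D) (hT : D ^ 3 < T)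
    (hl : StrictMono l) {s t : ℕ} (hst : s < t) {α β : DyadicIndex n}
    (hα : α ∈ stoppingTiling w T l s) (hβ : β ∈ stoppingTiling w T l t)
    (h : (enlargedCube k α ∩ enlargedCube k β).Nonempty) : α.1 < β.1 :=
  hw.level_lt hT hl hα (stoppingSet_antitone hw.pos ((one_le_pow₀ hw.one_le).trans hT.le) hl
    (Nat.succ_le_of_lt hst) hβ.1) h

/-- Towards smaller cubes `w` hardly decreases, so only a larger `β` is delicate. It was stopped by
growth from some level `l i`, while `α` has grown no more than that (up to `D`) from an adjacent
cube of the same level. The powers of `T` cancel. -/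
theorem IsSlowlyVarying.neighbours_le (hw : IsSlowlyVarying w D) (hT : 0 < T) {s : ℕ}
    {α β : DyadicIndex n}
    (hα : α ∈ stoppingTiling w T l s) (hβ : β ∈ stoppingTiling w T l s)
    (h : (enlargedCube k α ∩ enlargedCube k β).Nonempty) : w α ≤ D ^ 2 * w β := by
  have hD := hw.one_le
  have hD0 : 0 < D := one_pos.trans_le hD
  rcases le_or_gt α.1 β.1 with hle | hlt
  · have hadj := adjacent_ancestor_of_inter h hle
    calc w α ≤ D * w (ancestor α.1 β) := hw.le_adjacent _ _ hadj
      _ ≤ D * (D * w β) := by gcongr; exact hw.ancestor_le _ _ hle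
      _ = _ := by ring
  · have hadj := adjacent_ancestor_of_inter (by rwa [inter_comm]) hlt.le
    obtain ⟨i, hi, hil, hg⟩ :=
      exists_growth hβ.1 (hlt.trans_le (level_le_of_mem_stoppingTiling hα))
    have hadj' := (hadj.ancestor (l i)).symm
    rw [ancestor_ancestor hil hlt.le] at hadj'
    calc w α ≤ D * (T ^ (s - i) * w (ancestor (l i) α)) :=
          hw.le_of_mem_stoppingTiling hα hi (hil.trans_lt hlt)
      _ ≤ D * (T ^ (s - i) * (D * w (ancestor (l i) β))) := by
          gcongr; exact hw.le_adjacent _ _ hadj'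
      _ = D ^ 2 * (T ^ (s - i) * w (ancestor (l i) β)) := by ring
      _ ≤ D ^ 2 * w β := by gcongr

/-- Both growths are measured from one reference level: `l s` if `α` was stopped by size, otherwise
the level that stopped `α`. One step of `s` allows only one more factor `T`. -/
theorem IsSlowlyVarying.succ_le (hw : IsSlowlyVarying w D) (hT : 0 < T) {s : ℕ}
    {α β : DyadicIndex n} (hα : α ∈ stoppingTiling w T l s)
    (hβ : β ∈ stoppingTiling w T l (s + 1)) (hlt : α.1 < β.1) (hanc : ancestor α.1 β = α) :
    w β ≤ D * T * w α := by
  have hD0 : 0 < D := one_pos.trans_le hw.one_le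
  rcases hα.1 with h | ⟨i, hi, hil, hg⟩
  · have h1 : l s = α.1 := le_antisymm h (level_le_of_mem_stoppingTiling hα)
    have h2 := hw.le_of_mem_stoppingTiling hβ s.lt_succ_self (h.trans_lt hlt)
    rw [h1, hanc] at h2
    simpa [mul_assoc] using h2
  · have h2 := hw.le_of_mem_stoppingTiling hβ (hi.trans s.lt_succ_self) (hil.trans_lt hlt)
    have h3 : ancestor (l i) β = ancestor (l i) α := by
      rw [← ancestor_ancestor hil hlt.le, hanc]
    have e : T ^ (s + 1 - i) = T * T ^ (s - i) := by
      rw [← pow_succ']; congr 1; omega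
    calc w β ≤ D * (T ^ (s + 1 - i) * w (ancestor (l i) β)) := h2
      _ = D * T * (T ^ (s - i) * w (ancestor (l i) α)) := by rw [h3, e]; ring
      _ ≤ D * T * w α := by gcongr

/-- On overlapping cubes of different tilings `w` at least doubles, if the smaller one has been
stopped because of growth. -/
theorem IsSlowlyVarying.two_mul_le (hw : IsSlowlyVarying w D) (hT : 2 * D ^ 3 ≤ T)
    (hl : StrictMono l) {s t : ℕ} (hst : s < t) {α β : DyadicIndex n}
    (hα : α ∈ stoppingTiling w T l s) (hβ : β ∈ stoppingTiling w T l t) (hβl : β.1 ≠ l t)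
    (h : (enlargedCube k α ∩ enlargedCube k β).Nonempty) : 2 * w α ≤ w β := by
  have hD := hw.one_le
  have hD0 : 0 < D := one_pos.trans_le hD
  have hD3 : 1 ≤ D ^ 3 := one_le_pow₀ hD
  have hT1 : 1 ≤ T := by linarith
  have hlt := hw.level_lt_of_lt (by linarith) hl hst hα hβ h
  have hadj := adjacent_ancestor_of_inter h hlt.le
  have hT2 : 2 * D ^ 2 ≤ T := by nlinarith [pow_le_pow_right₀ hD (by norm_num : 2 ≤ 3)]
  obtain ⟨i, hi, hil, hg⟩ :=
    exists_growth hβ.1 (lt_of_le_of_ne (level_le_of_mem_stoppingTiling hβ) hβl)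
  -- If the reference level of `β` is at least as fine as `α`, all of its growth occurs below `α`.
  -- Otherwise `i < s`, and the growth of `α` from level `l i` is at most `D * T ^ (s - i)`. In both
  -- cases a spare factor `T ≥ 2 * D ^ 2` remains.
  rcases le_or_gt α.1 (l i) with hle | hgt
  · have h1 := hw.ancestor_le (ancestor (l i) β) α.1 hle
    rw [ancestor_ancestor hle hil] at h1
    calc 2 * w α ≤ 2 * (D * w (ancestor α.1 β)) := by gcongr; exact hw.le_adjacent _ _ hadj
      _ ≤ 2 * (D * (D * w (ancestor (l i) β))) := by gcongr
      _ = 2 * D ^ 2 * w (ancestor (l i) β) := by ring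
      _ ≤ T ^ (t - i) * w (ancestor (l i) β) := by
          have := hw.pos (ancestor (l i) β)
          gcongr
          exact hT2.trans (le_self_pow₀ hT1 (by omega))
      _ ≤ w β := hg
  · have his : i < s := hl.lt_iff_lt.1 (hgt.trans_le (level_le_of_mem_stoppingTiling hα))
    have hadj' := hadj.ancestor (l i)
    rw [ancestor_ancestor hgt.le hlt.le] at hadj'
    calc 2 * w α ≤ 2 * (D * (T ^ (s - i) * w (ancestor (l i) α))) := by
          gcongr; exact hw.le_of_mem_stoppingTiling hα his hgt
      _ ≤ 2 * (D * (T ^ (s - i) * (D * w (ancestor (l i) β)))) := by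
          gcongr; exact hw.le_adjacent _ _ hadj'
      _ = 2 * D ^ 2 * T ^ (s - i) * w (ancestor (l i) β) := by ring
      _ ≤ T * T ^ (s - i) * w (ancestor (l i) β) := by
          have := hw.pos (ancestor (l i) β)
          gcongr
      _ = T ^ (s - i + 1) * w (ancestor (l i) β) := by rw [pow_succ']
      _ ≤ T ^ (t - i) * w (ancestor (l i) β) := by
          have := hw.pos (ancestor (l i) β)
          gcongr
          · omega
      _ ≤ w β := hg

theorem isAdmissible_stoppingTiling {γ : Space n → ℝ}
    (hw : IsSlowlyVarying (meanWeight γ) D) (hT : 2 * D ^ 3 ≤ T) (hl : StrictMono l)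
    (hl0 : l 0 = 0) :
    IsAdmissible γ k (D ^ 2) (D * T) (stoppingTiling (meanWeight γ) T l) := by
  have hD := hw.one_le
  have hD0 : 0 < D := one_pos.trans_le hD
  have hD3 : 1 ≤ D ^ 3 := one_le_pow₀ hD
  have hT1 : 1 ≤ T := by linarith
  have hT3 : D ^ 3 < T := by linarith
  refine ⟨⟨fun s => isTiling_maximalIndices (l := l s) fun α hα => Or.inl hα,
    fun s => succeeds_maximalIndices (stoppingSet_succ_subset hw.pos hT1 hl s)⟩, ?_, ?_, ?_, ?_⟩
  · intro s α hα β hβ h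
    exact hw.neighbours_le (by linarith) hα hβ h
  · intro s α hα β hβ hsub
    obtain ⟨x, hx⟩ := dyadicCube_nonempty β
    have hlt : α.1 < β.1 := hw.level_lt (k := k) hT3 hl hα hβ.1
      ⟨x, dyadicCube_subset_enlargedCube k _ (hsub hx), dyadicCube_subset_enlargedCube k _ hx⟩
    have hanc := ancestor_eq_of_inter ⟨x, hsub hx, hx⟩ hlt.le
    refine ⟨?_, hw.succ_le (by linarith) hα hβ hlt hanc⟩
    have h1 := hw.ancestor_le β α.1 hlt.le
    rw [hanc] at h1
    refine h1.trans ?_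
    have := hw.pos β
    gcongr
    nlinarith
  · intro s x α hα β hβ hxα hxβ
    have hlt : α.1 < β.1 := hw.level_lt hT3 hl hα hβ.1 ⟨x, hxα, hxβ⟩
    unfold side
    rw [div_eq_mul_inv, ← mul_inv, ← pow_succ]
    exact inv_anti₀ (by positivity) (pow_le_pow_right₀ (by norm_num) hlt)
  · refine ⟨l, hl, hl0, fun s α hα => ?_⟩
    unfold side
    exact inv_anti₀ (by positivity)
      (pow_le_pow_right₀ (by norm_num) (level_le_of_mem_stoppingTiling hα))

end Stopping

/-! ### Reduced index sets -/

section Reduced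

variable {n : ℕ} {k : ℕ}

/-- The position of `α` relative to the cube of the same level containing `x`. -/
noncomputable def relativePosition (x : Fin n → ℝ) (α : DyadicIndex n) (i : Fin n) : ℤ :=
  α.2 i - ⌊x i * 2 ^ α.1⌋

theorem relativePosition_mem {x : Fin n → ℝ} {α : DyadicIndex n} (h : x ∈ enlargedCube k α)
    (i : Fin n) : relativePosition x α i ∈ Finset.Icc (-1 : ℤ) 1 := by
  obtain ⟨h1, h2⟩ := abs_lt.1 ((mem_enlargedCube_iff.1 h i).trans_le (half_enlargement_le k))
  have h3 := Int.floor_le (x i * 2 ^ α.1)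
  have h4 := Int.lt_floor_add_one (x i * 2 ^ α.1)
  have h5 : ((relativePosition x α i : ℤ) : ℝ) < 2 := by
    simp only [relativePosition]; push_cast; linarith
  have h6 : (-2 : ℝ) < ((relativePosition x α i : ℤ) : ℝ) := by
    simp only [relativePosition]; push_cast; linarith
  have h7 : relativePosition x α i < 2 := by exact_mod_cast h5
  have h8 : -2 < relativePosition x α i := by exact_mod_cast h6
  rw [Finset.mem_Icc]; omega

theorem eq_of_relativePosition_eq {x : Fin n → ℝ} {α β : DyadicIndex n} (hl : α.1 = β.1)
    (h : ∀ i, relativePosition x α i = relativePosition x β i) : α = β := by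
  refine Prod.ext hl (funext fun i => ?_)
  have := h i
  simp only [relativePosition, hl] at this
  omega

/-- Only finitely many enlarged cubes of bounded level contain a given point. -/
theorem finite_setOf_mem_enlargedCube (x : Fin n → ℝ) (L : ℕ) :
    {α : DyadicIndex n | α.1 ≤ L ∧ x ∈ enlargedCube k α}.Finite := by
  refine Set.Finite.of_finite_image (f := fun α => (α.1, relativePosition x α)) ?_ ?_
  · refine ((Set.finite_Iic L).prod
      (Set.Finite.pi' fun _ : Fin n => (Finset.Icc (-1 : ℤ) 1).finite_toSet)).subset ?_
    rintro _ ⟨α, ⟨h1, h2⟩, rfl⟩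
    exact ⟨h1, fun i => relativePosition_mem h2 i⟩
  · intro α _ β _ h
    obtain ⟨h1, h2⟩ := Prod.mk.inj h
    exact eq_of_relativePosition_eq h1 (congrFun h2)

/-- A tiling by cubes of bounded level has a reduced index set. -/
theorem exists_isReducedIndexSet {A : Set (DyadicIndex n)} (hA : IsTiling A) {L : ℕ}
    (hL : ∀ α ∈ A, α.1 ≤ L) (k : ℕ) : ∃ B, IsReducedIndexSet k A B := by
  let S : Set (Set (DyadicIndex n)) := {B | B ⊆ A ∧ ⋃ α ∈ B, enlargedCube k α = univ}
  have hAS : A ∈ S := by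
    refine ⟨subset_rfl, eq_univ_of_univ_subset ?_⟩
    rw [← hA.cover]
    exact iUnion₂_mono fun α _ => closedDyadicCube_subset_enlargedCube k α
  -- A minimal covering subfamily is irredundant. The intersection of a chain still covers, because
  -- only finitely many candidate cubes contain a given point.
  obtain ⟨B, hBA, hB⟩ := zorn_superset_nonempty S (fun c hc hchain hne => by
    refine ⟨⋂₀ c, ⟨?_, eq_univ_of_forall fun x => ?_⟩, fun s hs => sInter_subset_of_mem hs⟩
    · obtain ⟨B, hB⟩ := hne
      exact (sInter_subset_of_mem hB).trans (hc hB).1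
    · let F : Set (DyadicIndex n) := {α | α.1 ≤ L ∧ x ∈ enlargedCube k α}
      have hF : F.Finite := finite_setOf_mem_enlargedCube x L
      have hmeet : ∀ B ∈ c, (B ∩ F).Nonempty := by
        intro B hB
        obtain ⟨α, hα, hx⟩ := mem_iUnion₂.1 ((hc hB).2.symm ▸ mem_univ x)
        exact ⟨α, hα, hL α ((hc hB).1 hα), hx⟩
      by_contra hcon
      have hout : ∀ α ∈ F, ∃ B ∈ c, α ∉ B := by
        intro α hα
        by_contra! hall
        exact hcon (mem_biUnion (mem_sInter.2 hall) hα.2)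
      choose! g hg hgn using hout
      obtain ⟨B₀, hB₀⟩ := hne
      -- Each cube of the finite set is omitted by some member of the chain. The smallest of these
      -- members omits all of them at once.
      have hmin : ∀ G : Set (DyadicIndex n), G.Finite → G ⊆ F →
          ∃ B ∈ c, ∀ α ∈ G, α ∉ B := by
        intro G hG
        induction G, hG using Set.Finite.induction_on with
        | empty => exact fun _ => ⟨B₀, hB₀, by simp⟩
        | @insert a G _ _ ih =>
          intro hGF
          obtain ⟨B, hB, hBG⟩ := ih ((subset_insert a G).trans hGF)
          have ha : a ∈ F := hGF (mem_insert a G)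
          rcases hchain.total hB (hg a ha) with h | h
          · refine ⟨B, hB, ?_⟩
            rintro α (rfl | hα)
            · exact fun hm => hgn _ ha (h hm)
            · exact hBG α hα
          · refine ⟨g a, hg a ha, ?_⟩
            rintro α (rfl | hα)
            · exact hgn _ ha
            · exact fun hm => hBG α hα (h hm)
      obtain ⟨B, hB, hBF⟩ := hmin F hF subset_rfl
      obtain ⟨α, hα, hαF⟩ := hmeet B hB
      exact hBF α hαF hα) A hAS
  refine ⟨B, hB.prop.1, hB.prop.2, fun α hα hsub => ?_⟩
  have hmem : B \ {α} ∈ S := by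
    refine ⟨sdiff_subset.trans hB.prop.1, eq_univ_of_univ_subset ?_⟩
    rw [← hB.prop.2]
    refine iUnion₂_subset fun β hβ => ?_
    by_cases h : β = α
    · rw [h]; exact hsub
    · exact subset_iUnion₂_of_subset β ⟨hβ, h⟩ subset_rfl
  exact (hB.le_of_le hmem sdiff_subset hα).2 rfl

/-- The coordinate, oriented by the direction `d`, of the face of the enlarged cube in that
direction. -/
noncomputable def face (k : ℕ) (d : Fin n × Bool) (α : DyadicIndex n) : ℝ :=
  (if d.2 then (α.2 d.1 : ℝ) + 1 + (2 ^ (k + 1))⁻¹ else -((α.2 d.1 : ℝ) - (2 ^ (k + 1))⁻¹))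
    / 2 ^ α.1

/-- The coordinate of `x` oriented by the direction `d`. -/
noncomputable def orientedCoord (d : Fin n × Bool) (x : Fin n → ℝ) : ℝ := if d.2 then x d.1 else -x d.1

theorem mem_enlargedCube_iff_face {α : DyadicIndex n} {x : Fin n → ℝ} :
    x ∈ enlargedCube k α ↔ ∀ d, orientedCoord d x < face k d α := by
  have h : (0 : ℝ) < 2 ^ α.1 := by positivity
  rw [mem_enlargedCube_iff]
  simp only [face, orientedCoord, Prod.forall, Bool.forall_bool, lt_div_iff₀ h, pow_succ,
    mul_inv, abs_lt, if_true, Bool.false_eq_true, if_false]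
  refine forall_congr' fun i => ⟨fun ⟨h1, h2⟩ => ⟨?_, ?_⟩, fun ⟨h1, h2⟩ => ⟨?_, ?_⟩⟩ <;> linarith

theorem face_sub_orientedCoord_lt {α : DyadicIndex n} {x : Fin n → ℝ} (hx : x ∈ enlargedCube k α)
    (d : Fin n × Bool) : face k d α - orientedCoord d x < 2 / 2 ^ α.1 := by
  have h : (0 : ℝ) < 2 ^ α.1 := by positivity
  have hk := half_enlargement_le k
  obtain ⟨i, b⟩ := d
  obtain ⟨h1, h2⟩ := abs_lt.1 (mem_enlargedCube_iff.1 hx i)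
  rw [lt_div_iff₀ h, sub_mul, face, div_mul_cancel₀ _ h.ne']
  cases b <;> simp only [orientedCoord, pow_succ, mul_inv, if_true, Bool.false_eq_true, if_false]
    <;> linarith

/-- Distinct faces of enlarged cubes are separated, as they lie in a grid. -/
theorem le_face_sub_face {α β : DyadicIndex n} {d : Fin n × Bool} (hl : β.1 ≤ α.1)
    (h : face k d β < face k d α) :
    (2 ^ (α.1 + k + 1) : ℝ)⁻¹ ≤ face k d α - face k d β := by
  have key : ∀ δ : DyadicIndex n, δ.1 ≤ α.1 → ∃ z : ℤ, face k d δ * 2 ^ (α.1 + k + 1) = z := by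
    intro δ hδ
    have e : (2 : ℝ) ^ (α.1 + k + 1) = 2 ^ δ.1 * 2 ^ (α.1 - δ.1) * 2 ^ (k + 1) := by
      rw [← pow_add, ← pow_add]; congr 1; omega
    have h1 : (2 : ℝ) ^ δ.1 ≠ 0 := by positivity
    have h2 : (2 : ℝ) ^ (k + 1) ≠ 0 := by positivity
    obtain ⟨i, b⟩ := d
    cases b
    · refine ⟨-(δ.2 i * 2 ^ (k + 1) - 1) * 2 ^ (α.1 - δ.1), ?_⟩
      rw [e]; simp only [face, Bool.false_eq_true, if_false]; push_cast; field_simp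
    · refine ⟨((δ.2 i + 1) * 2 ^ (k + 1) + 1) * 2 ^ (α.1 - δ.1), ?_⟩
      rw [e]; simp only [face, if_true]; push_cast; field_simp
  obtain ⟨a, ha⟩ := key α le_rfl
  obtain ⟨b, hb⟩ := key β hl
  have hp : (0 : ℝ) < 2 ^ (α.1 + k + 1) := by positivity
  have hlt : (b : ℝ) < a := by rw [← ha, ← hb]; exact mul_lt_mul_of_pos_right h hp
  have hle : (b : ℝ) + 1 ≤ a := by exact_mod_cast hlt
  rw [inv_le_iff_one_le_mul₀ hp, sub_mul, ha, hb]
  linarith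

/-- The bound for the overlap of the enlarged cubes of a reduced index set. -/
noncomputable def overlapBound (n k : ℕ) : ℕ :=
  Nat.card (Fin (k + 2) × Finset (Fin n × Bool) ×
    (Fin n → {z : ℤ // z ∈ Finset.Icc (-1 : ℤ) 1}))

/-- An irredundant family of enlarged cubes has bounded overlap. -/
theorem card_le_overlapBound {B : Set (DyadicIndex n)}
    (hB : ∀ α ∈ B, ¬ enlargedCube k α ⊆ ⋃ β ∈ B \ {α}, enlargedCube k β) {x : Fin n → ℝ}
    {F : Finset (DyadicIndex n)} (hFB : ∀ α ∈ F, α ∈ B) (hF : ∀ α ∈ F, x ∈ enlargedCube k α) :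
    F.card ≤ overlapBound n k := by
  classical
  -- `S α` records the directions in which some larger cube of the family, with level in the same
  -- residue class mod `k + 2`, ends before `α` does. Together with the residue and the relative
  -- position it determines the cube.
  let S : DyadicIndex n → Finset (Fin n × Bool) := fun α =>
    Finset.univ.filter fun d => ∃ β ∈ F, β.1 < α.1 ∧ β.1 % (k + 2) = α.1 % (k + 2) ∧
      face k d β < face k d α
  let g : F → Fin (k + 2) × Finset (Fin n × Bool) × (Fin n → {z : ℤ // z ∈ Finset.Icc (-1 : ℤ) 1}) :=
    fun α => (⟨α.1.1 % (k + 2), Nat.mod_lt _ (by omega)⟩, S α,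
      fun i => ⟨relativePosition x α i, relativePosition_mem (hF α α.2) i⟩)
  have hS : ∀ α ∈ F, ∀ β ∈ F, α.1 < β.1 → α.1 % (k + 2) = β.1 % (k + 2) → S α ≠ S β := by
    intro α hα β hβ hlt hmod heq
    have hne : β ≠ α := fun h => by rw [h] at hlt; exact lt_irrefl _ hlt
    -- By irredundancy the smaller cube `β` sticks out of `α` in a direction `d`. If `S α = S β`, a
    -- still larger `δ` ends before `α` in that direction. All three contain `x`, so the gap between
    -- the faces of `δ` and `α` must fit inside the tiny cube `β`.
    obtain ⟨y, hy, hyn⟩ := not_subset.1 (hB β (hFB β hβ))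
    have hyα : y ∉ enlargedCube k α := fun h => hyn (mem_biUnion ⟨hFB α hα, hne.symm⟩ h)
    rw [mem_enlargedCube_iff_face] at hy hyα
    push Not at hyα
    obtain ⟨d, hd⟩ := hyα
    have hdβ : d ∈ S β := Finset.mem_filter.2 ⟨Finset.mem_univ _, α, hα, hlt, hmod,
      hd.trans_lt (hy d)⟩
    rw [← heq] at hdβ
    obtain ⟨-, δ, hδ, hδl, -, hδf⟩ := Finset.mem_filter.1 hdβ
    have h1 := le_face_sub_face hδl.le hδf
    have h2 := mem_enlargedCube_iff_face.1 (hF δ hδ) d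
    have h3 := face_sub_orientedCoord_lt (hF β hβ) d
    have h4 : (2 ^ (α.1 + k + 1) : ℝ)⁻¹ < 2 / 2 ^ β.1 := by linarith [hy d]
    -- Different levels in one residue class are at least `k + 2` apart. This is what makes the
    -- bound `2 / 2 ^ β.1` no larger than the grid spacing of the faces at level `α.1`.
    have h5 : α.1 + (k + 2) ≤ β.1 := by
      have := (Nat.modEq_iff_dvd' hlt.le).1 hmod
      have := Nat.le_of_dvd (by omega) this
      omega
    have h6 : (2 : ℝ) / 2 ^ β.1 ≤ (2 ^ (α.1 + k + 1))⁻¹ := by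
      rw [inv_eq_one_div, div_le_div_iff₀ (by positivity) (by positivity), one_mul, ← pow_succ']
      exact pow_le_pow_right₀ (by norm_num) (by omega)
    linarith
  have hg : Function.Injective g := by
    intro α β h
    simp only [g, Prod.mk.injEq, Fin.mk.injEq] at h
    obtain ⟨h1, h2, h3⟩ := h
    have hl : α.1.1 = β.1.1 := by
      rcases lt_trichotomy α.1.1 β.1.1 with hlt | he | hlt
      · exact absurd h2 (hS _ α.2 _ β.2 hlt h1)
      · exact he
      · exact absurd h2.symm (hS _ β.2 _ α.2 hlt h1.symm)
    exact Subtype.ext (eq_of_relativePosition_eq hl fun i =>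
      congrArg Subtype.val (congrFun h3 i))
  have := Nat.card_le_card_of_injective g hg
  rwa [Nat.card_eq_fintype_card, Fintype.card_coe] at this

end Reduced

/-! ### Weak derivatives and translations -/

instance instIsAddHaarMeasureSpace (n : ℕ) : (volume : Measure (Space n)).IsAddHaarMeasure :=
  Measure.prod.instIsAddHaarMeasure volume volume

section WeakDerivative

variable {n : ℕ}

/-- The integrands vanish off the support of the test function, so integrals over `V`, over `Ω` and
over the whole space coincide. -/
theorem HasWeakDeriv.mono {Ω V : Set (Space n)} {v : Space n} {f g : Space n → ℝ}
    (h : HasWeakDeriv Ω v f g) (hV : V ⊆ Ω) : HasWeakDeriv V v f g := by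
  refine ⟨h.1.mono_set hV, fun ψ hψ hc hs => ?_⟩
  have h0 : ∀ p ∉ tsupport ψ, fderiv ℝ ψ p = 0 := fun p hp =>
    Function.notMem_support.1 fun hp' => hp (support_fderiv_subset ℝ hp')
  have e1 : ∀ W, tsupport ψ ⊆ W → ∫ p in W, f p * fderiv ℝ ψ p v = ∫ p, f p * fderiv ℝ ψ p v :=
    fun W hW => setIntegral_eq_integral_of_forall_compl_eq_zero fun p hp => by
      simp [h0 p fun hp' => hp (hW hp')]
  have e2 : ∀ W, tsupport ψ ⊆ W → ∫ p in W, g p * ψ p = ∫ p, g p * ψ p :=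
    fun W hW => setIntegral_eq_integral_of_forall_compl_eq_zero fun p hp => by
      rw [image_eq_zero_of_notMem_tsupport fun hp' => hp (hW hp'), mul_zero]
  have := h.2 ψ hψ hc (hs.trans hV)
  rwa [e1 _ (hs.trans hV), e2 _ (hs.trans hV), ← e1 _ hs, ← e2 _ hs] at this

theorem HasWeakDeriv.congr {Ω : Set (Space n)} {v : Space n}
    {f g f' g' : Space n → ℝ}
    (h : HasWeakDeriv Ω v f g) (hf : f =ᵐ[volume.restrict Ω] f')
    (hg : g =ᵐ[volume.restrict Ω] g') : HasWeakDeriv Ω v f' g' := by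
  refine ⟨?_, fun ψ hψ hc hs => ?_⟩
  · intro p hp
    obtain ⟨W, hW, hi⟩ := h.1 p hp
    refine ⟨W ∩ Ω, inter_mem hW self_mem_nhdsWithin, ?_⟩
    exact (hi.mono_set inter_subset_left).congr_fun_ae
      (ae_mono (Measure.restrict_mono inter_subset_right le_rfl) hg)
  · have := h.2 ψ hψ hc hs
    have e1 : ∫ p in Ω, f p * fderiv ℝ ψ p v = ∫ p in Ω, f' p * fderiv ℝ ψ p v :=
      integral_congr_ae (hf.mono fun p hp => by simp only [hp])
    have e2 : ∫ p in Ω, g p * ψ p = ∫ p in Ω, g' p * ψ p :=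
      integral_congr_ae (hg.mono fun p hp => by simp only [hp])
    rwa [e1, e2] at this

theorem integrable_comp_add_smul {g : Space n → ℝ} (hgm : Measurable g) (hg : Integrable g)
    (v : Space n) : Integrable (fun q : Space n × ℝ => g (q.1 + q.2 • v))
      (volume.prod (volume.restrict (Ioc 0 1))) := by
  have hm : Measurable fun q : Space n × ℝ => g (q.1 + q.2 • v) := by fun_prop
  refine ⟨hm.aestronglyMeasurable, ?_⟩
  rw [HasFiniteIntegral, lintegral_prod_symm _ hm.enorm.aemeasurable]
  simp only [lintegral_add_right_eq_self (fun p => ‖g p‖ₑ)]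
  rw [lintegral_const, Measure.restrict_apply_univ, Real.volume_Ioc]
  simpa using hg.hasFiniteIntegral.ne.lt_top

/-- A function with a weak derivative in the direction `v` satisfies the fundamental theorem of
calculus along almost all segments of direction `v`. -/
theorem HasWeakDeriv.ae_eq_integral {V U : Set (Space n)} {v : Space n} {f g : Space n → ℝ}
    (h : HasWeakDeriv V v f g) (hV : IsOpen V) (hfm : Measurable f) (hgm : Measurable g)
    (hf : IntegrableOn f V) (hg : IntegrableOn g V) (hU : IsOpen U)
    (hUV : ∀ p ∈ U, ∀ s ∈ Icc (0 : ℝ) 1, p + s • v ∈ V) :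
    ∀ᵐ p, p ∈ U → f (p + v) - f p = ∫ s in (0 : ℝ)..1, g (p + s • v) := by
  have hVm := hV.measurableSet
  set f' := V.indicator f with hf'
  set g' := V.indicator g with hg'
  have hfm' : Measurable f' := hfm.indicator hVm
  have hgm' : Measurable g' := hgm.indicator hVm
  have hfi : Integrable f' := (integrable_indicator_iff hVm).2 hf
  have hgi : Integrable g' := (integrable_indicator_iff hVm).2 hg
  set ν := (volume : Measure ℝ).restrict (Ioc 0 1) with hν
  have hG : Integrable (fun q : Space n × ℝ => g' (q.1 + q.2 • v)) (volume.prod ν) :=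
    integrable_comp_add_smul hgm' hgi v
  have hfv : Integrable fun p => f' (p + v) := hfi.comp_add_right v
  have hGi : Integrable fun p => ∫ s, g' (p + s • v) ∂ν := hG.integral_prod_left
  have hloc : LocallyIntegrableOn (fun p => f' (p + v) - f' p - ∫ s, g' (p + s • v) ∂ν) U :=
    ((hfv.sub hfi).sub hGi).locallyIntegrable.locallyIntegrableOn U
  -- The identity is tested against smooth `ψ` supported in `U`. Translations are moved onto `ψ`,
  -- where the classical fundamental theorem (`e2`) applies.
  have key : ∀ᵐ p, p ∈ U → f' (p + v) - f' p - ∫ s, g' (p + s • v) ∂ν = 0 := by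
    refine hU.ae_eq_zero_of_integral_contDiff_smul_eq_zero hloc fun ψ hψ hc hs => ?_
    have hψd : Differentiable ℝ ψ := hψ.differentiable (by simp)
    have hψ' : Continuous (fun p => fderiv ℝ ψ p v) :=
      (hψ.continuous_fderiv (by simp)).clm_apply continuous_const
    obtain ⟨C, hC⟩ := hc.exists_bound_of_continuous hψ.continuous
    obtain ⟨C', hC'⟩ := (hc.fderiv_apply ℝ v).exists_bound_of_continuous hψ'
    have i1 : Integrable fun p => ψ p * f' (p + v) :=
      hfv.bdd_mul hψ.continuous.aestronglyMeasurable (ae_of_all _ hC)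
    have i2 : Integrable fun p => ψ p * f' p :=
      hfi.bdd_mul hψ.continuous.aestronglyMeasurable (ae_of_all _ hC)
    have i3 : Integrable fun p => ψ p * ∫ s, g' (p + s • v) ∂ν :=
      hGi.bdd_mul hψ.continuous.aestronglyMeasurable (ae_of_all _ hC)
    have i4 : Integrable fun p => ψ (p - v) * f' p :=
      hfi.bdd_mul (hψ.continuous.comp (continuous_sub_right v)).aestronglyMeasurable
        (ae_of_all _ fun p => hC _)
    have i5 : Integrable (fun q : Space n × ℝ => fderiv ℝ ψ (q.1 - q.2 • v) v * f' q.1)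
        (volume.prod ν) := by
      refine (hfi.comp_fst ν).bdd_mul (c := C') ?_ (ae_of_all _ fun q => hC' _)
      exact (hψ'.comp (by fun_prop : Continuous fun q : Space n × ℝ =>
        q.1 - q.2 • v)).aestronglyMeasurable
    have i6 : Integrable (fun q : Space n × ℝ => ψ q.1 * g' (q.1 + q.2 • v))
        (volume.prod ν) :=
      hG.bdd_mul (hψ.continuous.comp continuous_fst).aestronglyMeasurable
        (ae_of_all _ fun q => hC _)
    have e1 : ∫ p, ψ p * f' (p + v) = ∫ p, ψ (p - v) * f' p := by
      rw [← integral_add_right_eq_self (fun p => ψ (p - v) * f' p) v]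
      simp
    have e2 : ∀ p, ψ (p - v) - ψ p = -∫ s, fderiv ℝ ψ (p - s • v) v ∂ν := by
      intro p
      have hd : ∀ s ∈ uIcc (0 : ℝ) 1,
          HasDerivAt (fun s : ℝ => ψ (p - s • v)) (-(fderiv ℝ ψ (p - s • v) v)) s := by
        intro s _
        have h1 : HasDerivAt (fun s : ℝ => p - s • v) (-v) s := by
          simpa using ((hasDerivAt_id s).smul_const v).const_sub p
        have := (hψd (p - s • v)).hasFDerivAt.comp_hasDerivAt s h1
        rwa [map_neg] at this
      have hcont : Continuous fun s : ℝ => -(fderiv ℝ ψ (p - s • v) v) :=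
        (hψ'.comp (by fun_prop : Continuous fun s : ℝ => p - s • v)).neg
      have := intervalIntegral.integral_eq_sub_of_hasDerivAt hd (hcont.intervalIntegrable 0 1)
      rw [intervalIntegral.integral_of_le zero_le_one, integral_neg] at this
      simpa using this.symm
    -- The hypothesis `hUV` keeps the support of the translate of `ψ` by `s • v` inside `V`, so it
    -- is an admissible test function.
    have e3 : ∀ s ∈ Ioc (0 : ℝ) 1, ∫ p, fderiv ℝ ψ (p - s • v) v * f' p
        = -∫ p, ψ p * g' (p + s • v) := by
      intro s hs01
      have hd : ∀ p, fderiv ℝ (fun p => ψ (p - s • v)) p = fderiv ℝ ψ (p - s • v) := by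
        intro p
        exact fderiv_comp_sub (s • v)
      have hsupp : tsupport (fun p => ψ (p - s • v)) ⊆ V := by
        intro p hp
        have h1 : p - s • v ∈ tsupport ψ :=
          tsupport_comp_subset_preimage ψ (continuous_sub_right (s • v)) hp
        simpa using hUV _ (hs h1) s (Ioc_subset_Icc_self hs01)
      have hw := h.2 (fun p => ψ (p - s • v)) (hψ.comp (contDiff_id.sub contDiff_const))
        (hc.comp_homeomorph (Homeomorph.subRight (s • v))) hsupp
      simp only [hd] at hw
      have a1 : ∫ p in V, f p * fderiv ℝ ψ (p - s • v) v
          = ∫ p, fderiv ℝ ψ (p - s • v) v * f' p := by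
        rw [← integral_indicator hVm]
        congr 1; ext p
        by_cases hp : p ∈ V <;> simp [hf', hp, mul_comm]
      have a2 : ∫ p in V, g p * ψ (p - s • v) = ∫ p, ψ (p - s • v) * g' p := by
        rw [← integral_indicator hVm]
        congr 1; ext p
        by_cases hp : p ∈ V <;> simp [hg', hp, mul_comm]
      rw [a1, a2] at hw
      rw [hw, ← integral_add_right_eq_self (fun p => ψ (p - s • v) * g' p) (s • v)]
      simp
    have e4 : ∫ p, (ψ (p - v) * f' p - ψ p * f' p) = ∫ p, ψ p * ∫ s, g' (p + s • v) ∂ν := by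
      calc ∫ p, (ψ (p - v) * f' p - ψ p * f' p)
          = -∫ p, (∫ s, fderiv ℝ ψ (p - s • v) v * f' p ∂ν) := by
            rw [← integral_neg]
            congr 1; ext p
            rw [integral_mul_const, ← sub_mul, e2, neg_mul]
        _ = -∫ s, (∫ p, fderiv ℝ ψ (p - s • v) v * f' p) ∂ν := by
            rw [integral_integral_swap i5]
        _ = -∫ s, (-∫ p, ψ p * g' (p + s • v)) ∂ν := by
            congr 1
            exact setIntegral_congr_fun measurableSet_Ioc e3
        _ = ∫ s, (∫ p, ψ p * g' (p + s • v)) ∂ν := by rw [integral_neg, neg_neg]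
        _ = ∫ p, (∫ s, ψ p * g' (p + s • v) ∂ν) := (integral_integral_swap i6).symm
        _ = _ := by simp only [integral_const_mul]
    simp only [smul_eq_mul, mul_sub]
    have i7 : Integrable fun p => ψ p * f' (p + v) - ψ p * f' p := i1.sub i2
    rw [integral_sub i7 i3, integral_sub i1 i2, e1, ← integral_sub i4 i2, e4, sub_self]
  filter_upwards [key] with p hp hpU
  have hin : ∀ s ∈ Icc (0 : ℝ) 1, p + s • v ∈ V := hUV p hpU
  have h1 : f' (p + v) = f (p + v) := indicator_of_mem (by simpa using hin 1 (by simp)) f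
  have h0 : f' p = f p := indicator_of_mem (by simpa using hin 0 (by simp)) f
  have h2 : ∫ s, g' (p + s • v) ∂ν = ∫ s in (0 : ℝ)..1, g (p + s • v) := by
    rw [intervalIntegral.integral_of_le zero_le_one]
    exact setIntegral_congr_fun measurableSet_Ioc fun s hs =>
      indicator_of_mem (hin s (Ioc_subset_Icc_self hs)) g
  rw [← h0, ← h1, ← h2]
  linarith [hp hpU]

/-- The `L₁` norm of a difference is at most that of the weak derivative. -/
theorem HasWeakDeriv.lintegral_sub_le {V U : Set (Space n)} {v : Space n} {f g : Space n → ℝ}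
    (h : HasWeakDeriv V v f g) (hV : IsOpen V) (hfm : Measurable f) (hgm : Measurable g)
    (hf : IntegrableOn f V) (hg : IntegrableOn g V) (hU : IsOpen U)
    (hUV : ∀ p ∈ U, ∀ s ∈ Icc (0 : ℝ) 1, p + s • v ∈ V) :
    ∫⁻ p in U, ‖f (p + v) - f p‖ₑ ≤ ∫⁻ p in V, ‖g p‖ₑ := by
  have hVm := hV.measurableSet
  set g' := V.indicator g with hg'
  have hgm' : Measurable g' := hgm.indicator hVm
  have hm : Measurable fun q : Space n × ℝ => g' (q.1 + q.2 • v) := by fun_prop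
  calc ∫⁻ p in U, ‖f (p + v) - f p‖ₑ
      ≤ ∫⁻ p in U, ∫⁻ s in Ioc (0 : ℝ) 1, ‖g' (p + s • v)‖ₑ := by
        refine setLIntegral_mono_ae' hU.measurableSet ?_
        filter_upwards [h.ae_eq_integral hV hfm hgm hf hg hU hUV] with p hp hpU
        rw [hp hpU, intervalIntegral.integral_of_le zero_le_one]
        refine (enorm_integral_le_lintegral_enorm _).trans_eq ?_
        refine setLIntegral_congr_fun measurableSet_Ioc fun s hs => ?_
        simp only [hg', indicator_of_mem (hUV p hpU s (Ioc_subset_Icc_self hs))]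
    _ ≤ ∫⁻ p, ∫⁻ s in Ioc (0 : ℝ) 1, ‖g' (p + s • v)‖ₑ := setLIntegral_le_lintegral _ _
    _ = ∫⁻ s in Ioc (0 : ℝ) 1, ∫⁻ p, ‖g' (p + s • v)‖ₑ :=
        lintegral_lintegral_swap hm.enorm.aemeasurable
    _ = ∫⁻ p, ‖g' p‖ₑ := by
        simp only [lintegral_add_right_eq_self (fun p => ‖g' p‖ₑ)]
        simp
    _ = ∫⁻ p in V, ‖g p‖ₑ := by
        rw [← lintegral_indicator hVm]
        simp only [hg', enorm_indicator_eq_indicator_enorm]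

/-- Weak derivatives depend linearly on the direction. -/
theorem HasWeakDeriv.sum_smul {ι : Type*} [Fintype ι] {V : Set (Space n)} {v : ι → Space n}
    {f : Space n → ℝ} {g : ι → Space n → ℝ} (hf : IntegrableOn f V)
    (hg : ∀ i, IntegrableOn (g i) V) (h : ∀ i, HasWeakDeriv V (v i) f (g i)) (c : ι → ℝ) :
    HasWeakDeriv V (∑ i, c i • v i) f (fun p => ∑ i, c i * g i p) := by
  have hgi : IntegrableOn (fun p => ∑ i, c i * g i p) V :=
    integrable_finsetSum _ fun i _ => (hg i).const_mul (c i)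
  refine ⟨hgi.locallyIntegrableOn, fun ψ hψ hc hs => ?_⟩
  obtain ⟨C, hC⟩ := hc.exists_bound_of_continuous hψ.continuous
  have i1 : ∀ i, Integrable (fun p => f p * fderiv ℝ ψ p (v i)) (volume.restrict V) := by
    intro i
    have hψ' : Continuous (fun p => fderiv ℝ ψ p (v i)) :=
      (hψ.continuous_fderiv (by simp)).clm_apply continuous_const
    obtain ⟨C', hC'⟩ := (hc.fderiv_apply ℝ (v i)).exists_bound_of_continuous hψ'
    exact hf.mul_bdd hψ'.aestronglyMeasurable (ae_of_all _ hC')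
  have i2 : ∀ i, Integrable (fun p => g i p * ψ p) (volume.restrict V) := fun i =>
    (hg i).mul_bdd hψ.continuous.aestronglyMeasurable (ae_of_all _ hC)
  calc ∫ p in V, f p * fderiv ℝ ψ p (∑ i, c i • v i)
      = ∫ p in V, ∑ i, c i * (f p * fderiv ℝ ψ p (v i)) := by
        congr 1; ext p
        rw [map_sum, Finset.mul_sum]
        refine Finset.sum_congr rfl fun i _ => ?_
        rw [map_smul, smul_eq_mul]; ring
    _ = ∑ i, c i * -∫ p in V, g i p * ψ p := by
        rw [integral_finsetSum _ fun i _ => (i1 i).const_mul (c i)]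
        refine Finset.sum_congr rfl fun i _ => ?_
        rw [integral_const_mul, (h i).2 ψ hψ hc hs]
    _ = -∫ p in V, ∑ i, c i * (g i p * ψ p) := by
        rw [integral_finsetSum _ fun i _ => (i2 i).const_mul (c i)]
        simp [integral_const_mul]
    _ = -∫ p in V, (∑ i, c i * g i p) * ψ p := by
        simp only [Finset.sum_mul, mul_assoc]

end WeakDerivative

/-! ### Traces -/

section Cubes

variable {n : ℕ}

theorem cube_eq_pi (a : Fin n → ℝ) (r : ℝ) :
    cube a r = Set.pi univ fun i => Ioo (a i) (a i + r) := by
  ext x; simp [cube]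

theorem isOpen_cube (a : Fin n → ℝ) (r : ℝ) : IsOpen (cube a r) := by
  rw [cube_eq_pi]
  exact isOpen_set_pi finite_univ fun _ _ => isOpen_Ioo

theorem measurableSet_cube (a : Fin n → ℝ) (r : ℝ) : MeasurableSet (cube a r) :=
  (isOpen_cube a r).measurableSet

theorem volume_cube (a : Fin n → ℝ) (r : ℝ) : volume (cube a r) = ENNReal.ofReal r ^ n := by
  rw [cube_eq_pi, Real.volume_pi_Ioo]
  simp

theorem volume_cube_ne_top (a : Fin n → ℝ) (r : ℝ) : volume (cube a r) ≠ ∞ := by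
  rw [volume_cube]; exact ENNReal.pow_ne_top ENNReal.ofReal_ne_top

theorem volume_prod_Ioo (Q : Set (Fin n → ℝ)) (b c : ℝ) :
    volume (Q ×ˢ Ioo b c : Set (Space n)) = volume Q * ENNReal.ofReal (c - b) := by
  rw [Measure.volume_eq_prod, Measure.prod_prod, Real.volume_Ioo]

/-- The cubes centred at the origin with integer half-sides. -/
def centredCube (n j : ℕ) : Set (Fin n → ℝ) := cube (fun _ => -(j : ℝ)) (2 * j)

theorem exists_cube_subset_centredCube (a : Fin n → ℝ) (r : ℝ) :
    ∃ j, cube a r ⊆ centredCube n j := by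
  obtain ⟨j, hj⟩ := exists_nat_ge (‖a‖ + |r|)
  refine ⟨j, fun x hx i => ?_⟩
  have h1 := (Real.norm_eq_abs (a i) ▸ norm_le_pi_norm a i : |a i| ≤ ‖a‖)
  have h2 := abs_le.1 h1
  have h3 := le_abs_self r
  have h4 := abs_nonneg r
  constructor <;> linarith [(hx i).1, (hx i).2]

theorem exists_mem_centredCube (x : Fin n → ℝ) : ∃ j, x ∈ centredCube n j := by
  obtain ⟨j, hj⟩ := exists_cube_subset_centredCube (fun i => x i - 1) 2
  exact ⟨j, hj fun i => ⟨by linarith, by linarith⟩⟩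

end Cubes

/-! ### Absolute continuity in the vertical variable -/

section Slices

variable {n : ℕ}

theorem ae_ae_of_ae_prod_swap {α β : Type*} [MeasurableSpace α] [MeasurableSpace β]
    {μ : Measure α} {ν : Measure β} [SFinite μ] [SFinite ν] {P : α × β → Prop}
    (h : ∀ᵐ p ∂μ.prod ν, P p) : ∀ᵐ y ∂ν, ∀ᵐ x ∂μ, P (x, y) :=
  Measure.ae_ae_of_ae_prod (p := fun q : β × α => P q.swap)
    ((Measure.measurePreserving_swap (μ := ν) (ν := μ)).quasiMeasurePreserving.ae h)

theorem measurableSet_setOf_ae {α β : Type*} [MeasurableSpace α] [MeasurableSpace β]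
    {ν : Measure β} [SFinite ν] {P : α × β → Prop} (h : MeasurableSet {p | P p}) :
    MeasurableSet {x : α | ∀ᵐ y ∂ν, P (x, y)} := by
  have : Measurable fun x : α => ν (Prod.mk x ⁻¹' {p | P p}ᶜ) :=
    measurable_measure_prodMk_left h.compl
  exact this (measurableSet_singleton 0)

/-- Joint measurability in both endpoints and in `x` is needed to apply Fubini to the exceptional
set of pairs of heights. -/
theorem measurable_intervalIntegral {F : Space n → ℝ} (hF : Measurable F) :
    Measurable fun q : (ℝ × ℝ) × (Fin n → ℝ) => ∫ s in q.1.1..q.1.2, F (q.2, s) := by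
  have key : ∀ u v : (ℝ × ℝ) × (Fin n → ℝ) → ℝ, Measurable u → Measurable v →
      Measurable fun q : (ℝ × ℝ) × (Fin n → ℝ) => ∫ s in Ioc (u q) (v q), F (q.2, s) := by
    intro u v hu hv
    let S : Set (((ℝ × ℝ) × (Fin n → ℝ)) × ℝ) := {z | u z.1 < z.2 ∧ z.2 ≤ v z.1}
    have hS : MeasurableSet S :=
      (measurableSet_lt (hu.comp measurable_fst) measurable_snd).inter
        (measurableSet_le measurable_snd (hv.comp measurable_fst))
    have hm : StronglyMeasurable (Function.uncurry fun (q : (ℝ × ℝ) × (Fin n → ℝ)) (s : ℝ) =>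
        S.indicator (fun z => F (z.1.2, z.2)) (q, s)) := by
      refine (Measurable.indicator ?_ hS).stronglyMeasurable
      fun_prop
    convert (hm.integral_prod_right (ν := volume)).measurable using 2 with q
    rw [← integral_indicator measurableSet_Ioc]
    rfl
  simp only [intervalIntegral]
  exact (key (fun q => q.1.1) (fun q => q.1.2) (by fun_prop) (by fun_prop)).sub
    (key (fun q => q.1.2) (fun q => q.1.1) (by fun_prop) (by fun_prop))

theorem HasWeakDeriv.const_smul {V : Set (Space n)} {v : Space n} {f g : Space n → ℝ}
    (h : HasWeakDeriv V v f g) (c : ℝ) : HasWeakDeriv V (c • v) f (fun p => c * g p) := by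
  refine ⟨h.1.smul c, fun ψ hψ hc hs => ?_⟩
  calc ∫ p in V, f p * fderiv ℝ ψ p (c • v) = ∫ p in V, c * (f p * fderiv ℝ ψ p v) := by
        congr 1; ext p; rw [map_smul, smul_eq_mul]; ring
    _ = -∫ p in V, c * g p * ψ p := by
        simp only [mul_assoc, integral_const_mul, h.2 ψ hψ hc hs, mul_neg]

/-- A function with a weak derivative in `t` is an integral of this derivative on almost all pairs
of horizontal slices. -/
theorem HasWeakDeriv.ae_sub_eq_intervalIntegral {Q : Set (Fin n → ℝ)} (hQ : IsOpen Q) {r : ℝ}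
    {f F : Space n → ℝ} (h : HasWeakDeriv (Q ×ˢ Ioo 0 r) (dirT n) f F) (hfm : Measurable f)
    (hFm : Measurable F) (hf : IntegrableOn f (Q ×ˢ Ioo 0 r)) (hF : IntegrableOn F (Q ×ˢ Ioo 0 r)) :
    ∀ᵐ a : ℝ, a ∈ Ioo 0 r → ∀ᵐ b : ℝ, b ∈ Ioo 0 r → ∀ᵐ x, x ∈ Q →
      f (x, b) - f (x, a) = ∫ s in a..b, F (x, s) := by
  let R : ℝ × ℝ → Prop := fun z => ∀ᵐ x, 0 < z.1 → z.1 < z.2 → z.2 < r → x ∈ Q →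
    f (x, z.2) - f (x, z.1) = ∫ s in z.1..z.2, F (x, s)
  have hRm : MeasurableSet {z | R z} := by
    refine measurableSet_setOf_ae (P := fun q : (ℝ × ℝ) × (Fin n → ℝ) =>
      0 < q.1.1 → q.1.1 < q.1.2 → q.1.2 < r → q.2 ∈ Q →
        f (q.2, q.1.2) - f (q.2, q.1.1) = ∫ s in q.1.1..q.1.2, F (q.2, s)) ?_
    refine (measurableSet_lt measurable_const (by fun_prop)).imp
      ((measurableSet_lt (by fun_prop) (by fun_prop)).imp
      ((measurableSet_lt (by fun_prop) measurable_const).imp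
      ((measurable_snd hQ.measurableSet).imp
      (measurableSet_eq_fun (by fun_prop) (measurable_intervalIntegral hFm)))))
  have h1 : ∀ τ : ℝ, ∀ᵐ t, R (t, t + τ) := by
    intro τ
    rcases le_or_gt τ 0 with hτ | hτ
    · refine ae_of_all _ fun t => ae_of_all _ fun x _ hlt => ?_
      simp only at hlt
      linarith
    · have hU : IsOpen (Q ×ˢ Ioo 0 (r - τ) : Set (Space n)) := hQ.prod isOpen_Ioo
      have := (h.const_smul τ).ae_eq_integral (hQ.prod isOpen_Ioo) hfm (hFm.const_mul τ) hf
        (hF.const_mul τ) hU (by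
          rintro ⟨x, t⟩ ⟨hx, ht⟩ s ⟨hs0, hs1⟩
          simp only [mem_Ioo] at ht
          have : s * τ ≤ τ := by nlinarith
          have : 0 ≤ s * τ := by positivity
          simp only [dirT, Prod.smul_mk, smul_zero, smul_eq_mul, mul_one, Prod.mk_add_mk, add_zero]
          exact ⟨hx, by simp only; linarith [ht.1], by simp only; linarith [ht.2]⟩)
      rw [Measure.volume_eq_prod] at this
      filter_upwards [ae_ae_of_ae_prod_swap this] with t ht
      filter_upwards [ht] with x hx ht0 _ htr hxQ
      have e := hx ⟨hxQ, ht0, by simp only at htr ⊢; linarith⟩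
      simp only [dirT, Prod.smul_mk, smul_zero, smul_eq_mul, mul_one, Prod.mk_add_mk,
        add_zero] at e
      rw [e]
      have e2 := intervalIntegral.smul_integral_comp_add_mul (a := 0) (b := 1)
        (fun s => F (x, s)) τ t
      rw [mul_zero, add_zero, mul_one] at e2
      rw [← e2, intervalIntegral.integral_const_mul, smul_eq_mul]
      simp only [mul_comm τ]
  -- For each displacement `τ` the exceptional null set of heights depends on `τ`. Fubini exchanges
  -- the quantifiers, and a shift then gives almost all pairs of heights.
  have h2 : ∀ᵐ t, ∀ᵐ τ : ℝ, R (t, t + τ) := by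
    refine (Measure.ae_ae_comm (p := fun τ t : ℝ => R (t, t + τ)) ?_).1 (ae_of_all _ h1)
    exact (by fun_prop : Measurable fun z : ℝ × ℝ => (z.2, z.2 + z.1)) hRm
  have h3 : ∀ᵐ a, ∀ᵐ b : ℝ, R (a, b) := by
    filter_upwards [h2] with a ha
    filter_upwards [(measurePreserving_sub_right volume a).quasiMeasurePreserving.ae ha] with b hb
    simpa using hb
  have h4 : ∀ᵐ a, ∀ᵐ b : ℝ, R (b, a) :=
    (Measure.ae_ae_comm (p := fun b a : ℝ => R (b, a)) hRm).1 h3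
  filter_upwards [h3, h4] with a h3 h4 ha
  filter_upwards [h3, h4] with b h3 h4 hb
  filter_upwards [h3, h4] with x h3 h4 hx
  rcases lt_trichotomy a b with hab | rfl | hab
  · exact h3 ha.1 hab hb.2 hx
  · simp
  · rw [intervalIntegral.integral_symm, ← h4 hb.1 hab ha.2 hx]
    simp

end Slices

/-! ### Existence of the trace and its distance to slices -/

section Trace

variable {n : ℕ} {f F : Space n → ℝ}

theorem prod_Ioo_subset_upperHalf (Q : Set (Fin n → ℝ)) (r : ℝ) :
    (Q ×ˢ Ioo 0 r : Set (Space n)) ⊆ upperHalf n := fun _ hp => hp.2.1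

theorem setLIntegral_prod_Ioo {g : Space n → ℝ≥0∞} (hg : Measurable g) (Q : Set (Fin n → ℝ))
    (b c : ℝ) :
    ∫⁻ p in Q ×ˢ Ioo b c, g p = ∫⁻ x in Q, ∫⁻ t in Ioo b c, g (x, t) := by
  rw [Measure.volume_eq_prod, ← Measure.prod_restrict, lintegral_prod _ hg.aemeasurable]

theorem setLIntegral_prod_Ioo_symm {g : Space n → ℝ≥0∞} (hg : Measurable g)
    (Q : Set (Fin n → ℝ)) (b c : ℝ) :
    ∫⁻ p in Q ×ˢ Ioo b c, g p = ∫⁻ t in Ioo b c, ∫⁻ x in Q, g (x, t) := by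
  rw [Measure.volume_eq_prod, ← Measure.prod_restrict, lintegral_prod_symm _ hg.aemeasurable]

theorem enorm_intervalIntegral_le {u : ℝ → ℝ} {a b : ℝ} (hab : a ≤ b) :
    ‖∫ s in a..b, u s‖ₑ ≤ ∫⁻ s in Ioo a b, ‖u s‖ₑ := by
  rw [intervalIntegral.integral_of_le hab, integral_Ioc_eq_integral_Ioo]
  exact enorm_integral_le_lintegral_enorm _

/-- A function with an integrable weak derivative in `t` has a trace. -/
theorem exists_isTrace (h : HasWeakDeriv (upperHalf n) (dirT n) f F) (hfm : Measurable f)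
    (hFm : Measurable F) (hf : ∀ j, IntegrableOn f (centredCube n j ×ˢ Ioo 0 1))
    (hF : ∀ j, IntegrableOn F (centredCube n j ×ˢ Ioo 0 1)) : ∃ φ, IsTrace f φ := by
  have hab : ∀ᵐ a : ℝ, ∀ j, a ∈ Ioo (0 : ℝ) 1 → ∀ᵐ b : ℝ, b ∈ Ioo (0 : ℝ) 1 →
      ∀ᵐ x, x ∈ centredCube n j → f (x, b) - f (x, a) = ∫ s in a..b, F (x, s) :=
    ae_all_iff.2 fun j => (h.mono (prod_Ioo_subset_upperHalf _ 1)).ae_sub_eq_intervalIntegral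
      (isOpen_cube _ _) hfm hFm (hf j) (hF j)
  have hslice : ∀ᵐ a : ℝ, ∀ j, a ∈ Ioo (0 : ℝ) 1 →
      IntegrableOn (fun x => f (x, a)) (centredCube n j) := by
    refine ae_all_iff.2 fun j => (ae_restrict_iff' measurableSet_Ioo).1 ?_
    have := hf j
    rw [IntegrableOn, Measure.volume_eq_prod, ← Measure.prod_restrict] at this
    exact this.prod_left_ae
  have hFx : ∀ᵐ x, IntegrableOn (fun s => F (x, s)) (Ioo (0 : ℝ) 1) := by
    have : ∀ᵐ x, ∀ j, x ∈ centredCube n j → IntegrableOn (fun s => F (x, s)) (Ioo (0 : ℝ) 1) := by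
      refine ae_all_iff.2 fun j => (ae_restrict_iff' (measurableSet_cube _ _)).1 ?_
      have := hF j
      rw [IntegrableOn, Measure.volume_eq_prod, ← Measure.prod_restrict] at this
      exact this.prod_right_ae
    filter_upwards [this] with x hx
    obtain ⟨j, hj⟩ := exists_mem_centredCube x
    exact hx j hj
  obtain ⟨a, ⟨ha1, ha2⟩, ha⟩ : ∃ a : ℝ, ((∀ j, a ∈ Ioo (0 : ℝ) 1 → ∀ᵐ b : ℝ, b ∈ Ioo (0 : ℝ) 1 →
      ∀ᵐ x, x ∈ centredCube n j → f (x, b) - f (x, a) = ∫ s in a..b, F (x, s)) ∧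
      ∀ j, a ∈ Ioo (0 : ℝ) 1 → IntegrableOn (fun x => f (x, a)) (centredCube n j)) ∧
      a ∈ Ioo (0 : ℝ) 1 := by
    have hne : (ae ((volume : Measure ℝ).restrict (Ioo 0 1))).NeBot := by
      rw [ae_neBot, Ne, Measure.restrict_eq_zero]; simp
    exact ((ae_restrict_of_ae (hab.and hslice)).and (ae_restrict_mem measurableSet_Ioo)).exists
  -- From a good slice at height `a`, integration of the `t`-derivative down to 0 gives the trace,
  -- and integration to height `t` gives the representative.
  let φ : (Fin n → ℝ) → ℝ := fun x => f (x, a) - ∫ s in (0 : ℝ)..a, F (x, s)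
  let g : Space n → ℝ := fun p =>
    if p.2 < 1 then f (p.1, a) + ∫ s in a..p.2, F (p.1, s) else f p
  have hJ := measurable_intervalIntegral hFm
  refine ⟨φ, ?_, g, ?_, ?_⟩
  · intro x
    obtain ⟨j, hj⟩ := exists_mem_centredCube x
    refine ⟨centredCube n j, (isOpen_cube _ _).mem_nhds hj, (ha2 j ha).sub ⟨?_, ?_⟩⟩
    · exact (hJ.comp (by fun_prop : Measurable fun x : Fin n → ℝ =>
        (((0 : ℝ), a), x))).aestronglyMeasurable
    · calc ∫⁻ x in centredCube n j, ‖∫ s in (0 : ℝ)..a, F (x, s)‖ₑ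
          ≤ ∫⁻ x in centredCube n j, ∫⁻ s in Ioo 0 1, ‖F (x, s)‖ₑ :=
            lintegral_mono fun x => (enorm_intervalIntegral_le ha.1.le).trans
              (lintegral_mono_set (Ioo_subset_Ioo_right ha.2.le))
        _ = ∫⁻ p in centredCube n j ×ˢ Ioo 0 1, ‖F p‖ₑ :=
            (setLIntegral_prod_Ioo hFm.enorm _ _ _).symm
        _ < ∞ := (hF j).2
  · have hm : MeasurableSet {z : ℝ × (Fin n → ℝ) | z.1 ∈ Ioo (0 : ℝ) 1 →
        f (z.2, z.1) - f (z.2, a) = ∫ s in a..z.1, F (z.2, s)} :=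
      (measurable_fst measurableSet_Ioo).imp (measurableSet_eq_fun (by fun_prop)
        (hJ.comp (by fun_prop : Measurable fun z : ℝ × (Fin n → ℝ) => ((a, z.1), z.2))))
    have hae : ∀ᵐ z : ℝ × (Fin n → ℝ) ∂volume.prod volume, z.1 ∈ Ioo (0 : ℝ) 1 →
        f (z.2, z.1) - f (z.2, a) = ∫ s in a..z.1, F (z.2, s) := by
      rw [Measure.ae_prod_iff_ae_ae hm]
      filter_upwards [ae_all_iff.2 fun j => ha1 j ha] with b hb
      by_cases hb01 : b ∈ Ioo (0 : ℝ) 1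
      · filter_upwards [ae_all_iff.2 fun j => hb j hb01] with x hx _
        obtain ⟨j, hj⟩ := exists_mem_centredCube x
        exact hx j hj
      · exact ae_of_all _ fun x hb' => absurd hb' hb01
    have hae' : ∀ᵐ p : Space n, p.2 ∈ Ioo (0 : ℝ) 1 →
        f p - f (p.1, a) = ∫ s in a..p.2, F (p.1, s) :=
      (Measure.measurePreserving_swap (μ := (volume : Measure (Fin n → ℝ)))
        (ν := (volume : Measure ℝ))).quasiMeasurePreserving.ae hae
    have hup : MeasurableSet (upperHalf n) := measurableSet_lt measurable_const measurable_snd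
    refine (ae_restrict_iff' hup).2 ?_
    filter_upwards [hae'] with p hp hp0
    simp only [g]
    split_ifs with h1
    · rw [← hp ⟨hp0, h1⟩]; ring
    · rfl
  · intro c r hr
    obtain ⟨j, hj⟩ := exists_cube_subset_centredCube c r
    -- Absolute continuity of the integral: the boxes below height `t` have measure tending to 0.
    -- The indicator makes the integrand globally integrable.
    have hlim : Tendsto (fun t : ℝ => ∫⁻ p in cube c r ×ˢ Ioo 0 t,
        (centredCube n j ×ˢ Ioo (0 : ℝ) 1).indicator (fun p => ‖F p‖ₑ) p) (𝓝[>] 0) (𝓝 0) := by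
      refine tendsto_setLIntegral_zero ?_ ?_
      · have hm : MeasurableSet (centredCube n j) := measurableSet_cube _ _
        rw [lintegral_indicator (hm.prod measurableSet_Ioo)]
        exact (hF j).2.ne
      · have : Tendsto (fun t : ℝ => volume (cube c r) * ENNReal.ofReal (t - 0)) (𝓝 0)
            (𝓝 (volume (cube c r) * ENNReal.ofReal (0 - 0))) :=
          ENNReal.Tendsto.const_mul (ENNReal.tendsto_ofReal (tendsto_id.sub tendsto_const_nhds))
            (Or.inr (volume_cube_ne_top c r))
        simp only [sub_self, ENNReal.ofReal_zero, mul_zero] at this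
        refine (this.mono_left nhdsWithin_le_nhds).congr fun t => ?_
        rw [Function.comp_apply, volume_prod_Ioo]
    refine tendsto_of_tendsto_of_tendsto_of_le_of_le' tendsto_const_nhds hlim
      (Eventually.of_forall fun _ => zero_le) ?_
    filter_upwards [Ioo_mem_nhdsGT (zero_lt_one : (0 : ℝ) < 1)] with t ht
    have hsub : cube c r ×ˢ Ioo 0 t ⊆ centredCube n j ×ˢ Ioo (0 : ℝ) 1 :=
      prod_mono hj (Ioo_subset_Ioo_right ht.2.le)
    have e : ∫⁻ p in cube c r ×ˢ Ioo 0 t,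
        (centredCube n j ×ˢ Ioo (0 : ℝ) 1).indicator (fun p => ‖F p‖ₑ) p
        = ∫⁻ p in cube c r ×ˢ Ioo 0 t, ‖F p‖ₑ :=
      setLIntegral_congr_fun ((measurableSet_cube _ _).prod measurableSet_Ioo) fun p hp =>
        indicator_of_mem (hsub hp) _
    rw [e, setLIntegral_prod_Ioo hFm.enorm]
    refine setLIntegral_mono_ae' (measurableSet_cube _ _) ?_
    filter_upwards [hFx] with x hx _
    have hi : ∀ u ∈ Icc (0 : ℝ) 1, ∀ v ∈ Icc (0 : ℝ) 1,
        IntervalIntegrable (fun s => F (x, s)) volume u v := by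
      intro u hu v hv
      rw [intervalIntegrable_iff]
      refine ((integrableOn_Ioc_iff_integrableOn_Ioo).2 hx).mono_set ?_
      exact Ioc_subset_Ioc (le_min hu.1 hv.1) (max_le hu.2 hv.2)
    have e2 : φ x - g (x, t) = -∫ s in (0 : ℝ)..t, F (x, s) := by
      simp only [φ, g, if_pos ht.2]
      rw [← intervalIntegral.integral_add_adjacent_intervals
        (hi 0 (by simp) a (Ioo_subset_Icc_self ha))
        (hi a (Ioo_subset_Icc_self ha) t (Ioo_subset_Icc_self ht))]
      ring
    rw [e2, enorm_neg]
    exact enorm_intervalIntegral_le ht.1.le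

/-- The distance in `L₁` between the trace and almost every slice. -/
theorem IsTrace.ae_lintegral_sub_le {φ : (Fin n → ℝ) → ℝ} (hφ : IsTrace f φ)
    {a : Fin n → ℝ} {ρ r : ℝ} (hρ : 0 < ρ)
    (h : HasWeakDeriv (cube a ρ ×ˢ Ioo 0 r) (dirT n) f F) (hfm : Measurable f)
    (hFm : Measurable F) (hf : IntegrableOn f (cube a ρ ×ˢ Ioo 0 r))
    (hF : IntegrableOn F (cube a ρ ×ˢ Ioo 0 r)) :
    ∀ᵐ t : ℝ, t ∈ Ioo 0 r →
      ∫⁻ x in cube a ρ, ‖φ x - f (x, t)‖ₑ ≤ ∫⁻ p in cube a ρ ×ˢ Ioo 0 r, ‖F p‖ₑ := by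
  obtain ⟨-, g, hg, hlim⟩ := hφ
  have hup : MeasurableSet (upperHalf n) := measurableSet_lt measurable_const measurable_snd
  have hslice : ∀ᵐ t : ℝ, ∀ᵐ x, 0 < t → g (x, t) = f (x, t) := by
    have := (ae_restrict_iff' hup).1 hg
    rw [Measure.volume_eq_prod] at this
    exact ae_ae_of_ae_prod_swap this
  filter_upwards [h.ae_sub_eq_intervalIntegral (isOpen_cube _ _) hfm hFm hf hF] with t hab ht
  -- The slice at height `t` is compared with a generic slice at height `s < t` so low that it is
  -- within `ε` of the trace. The vertical integral between the two heights is at most the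
  -- right-hand side.
  refine ENNReal.le_of_forall_pos_le_add fun ε hε _ => ?_
  have hev := (hlim a ρ hρ).eventually (gt_mem_nhds (ENNReal.coe_pos.2 hε))
  obtain ⟨δ, hδ, hδsub⟩ := mem_nhdsGT_iff_exists_Ioo_subset.1 hev
  have hne : (ae ((volume : Measure ℝ).restrict (Ioo 0 (min δ t)))).NeBot := by
    have : 0 < min δ t := lt_min hδ ht.1
    rw [ae_neBot, Ne, Measure.restrict_eq_zero]; simpa using this
  obtain ⟨s, ⟨hs1, hs2⟩, hs⟩ := ((ae_restrict_of_ae ((hab ht).and hslice)).and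
    (ae_restrict_mem (s := Ioo 0 (min δ t)) measurableSet_Ioo)).exists
  have hst : s < t := hs.2.trans_le (min_le_right _ _)
  have hsmall : ∫⁻ x in cube a ρ, ‖φ x - g (x, s)‖ₑ < ε :=
    hδsub ⟨hs.1, hs.2.trans_le (min_le_left _ _)⟩
  have e1 : ∫⁻ x in cube a ρ, ‖φ x - g (x, s)‖ₑ = ∫⁻ x in cube a ρ, ‖φ x - f (x, s)‖ₑ := by
    refine lintegral_congr_ae (ae_restrict_of_ae ?_)
    filter_upwards [hs2] with x hx
    simp only [hx hs.1]
  have e2 : ∫⁻ x in cube a ρ, ‖f (x, s) - f (x, t)‖ₑ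
      ≤ ∫⁻ p in cube a ρ ×ˢ Ioo 0 r, ‖F p‖ₑ := by
    rw [setLIntegral_prod_Ioo hFm.enorm]
    refine setLIntegral_mono_ae' (measurableSet_cube _ _) ?_
    filter_upwards [hs1 ⟨hs.1, hst.trans ht.2⟩] with x hx hxQ
    rw [hx hxQ, intervalIntegral.integral_symm, enorm_neg]
    exact (enorm_intervalIntegral_le hst.le).trans
      (lintegral_mono_set (Ioo_subset_Ioo hs.1.le ht.2.le))
  calc ∫⁻ x in cube a ρ, ‖φ x - f (x, t)‖ₑ
      ≤ ∫⁻ x in cube a ρ, (‖φ x - f (x, s)‖ₑ + ‖f (x, s) - f (x, t)‖ₑ) := by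
        refine lintegral_mono fun x => ?_
        have := enorm_add_le (φ x - f (x, s)) (f (x, s) - f (x, t))
        rwa [sub_add_sub_cancel] at this
    _ = (∫⁻ x in cube a ρ, ‖φ x - f (x, s)‖ₑ) + ∫⁻ x in cube a ρ, ‖f (x, s) - f (x, t)‖ₑ :=
        lintegral_add_right _ (by fun_prop : Measurable fun x => ‖f (x, s) - f (x, t)‖ₑ)
    _ ≤ (∫⁻ p in cube a ρ ×ˢ Ioo 0 r, ‖F p‖ₑ) + ε := by
        rw [add_comm, ← e1]
        exact add_le_add e2 hsmall.le

end Trace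

/-! ### Estimates for the trace -/

section TraceEstimates

variable {n : ℕ} {f F : Space n → ℝ} {G : Fin n → Space n → ℝ}

/-- The triangle inequality through the slice at height `t`, averaged over `t` in `(0, 1)`. -/
theorem IsTrace.lintegral_le {φ : (Fin n → ℝ) → ℝ} (hφ : IsTrace f φ)
    {a : Fin n → ℝ} {ρ : ℝ} (hρ : 0 < ρ)
    (h : HasWeakDeriv (cube a ρ ×ˢ Ioo 0 1) (dirT n) f F) (hfm : Measurable f)
    (hFm : Measurable F) (hf : IntegrableOn f (cube a ρ ×ˢ Ioo 0 1))
    (hF : IntegrableOn F (cube a ρ ×ˢ Ioo 0 1)) :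
    ∫⁻ x in cube a ρ, ‖φ x‖ₑ ≤
      (∫⁻ p in cube a ρ ×ˢ Ioo 0 1, ‖f p‖ₑ) + ∫⁻ p in cube a ρ ×ˢ Ioo 0 1, ‖F p‖ₑ := by
  set I := ∫⁻ p in cube a ρ ×ˢ Ioo 0 1, ‖F p‖ₑ
  have key : ∀ᵐ t : ℝ, t ∈ Ioo (0 : ℝ) 1 →
      ∫⁻ x in cube a ρ, ‖φ x‖ₑ ≤ (∫⁻ x in cube a ρ, ‖f (x, t)‖ₑ) + I := by
    filter_upwards [hφ.ae_lintegral_sub_le hρ h hfm hFm hf hF] with t ht ht01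
    calc ∫⁻ x in cube a ρ, ‖φ x‖ₑ
        ≤ ∫⁻ x in cube a ρ, (‖f (x, t)‖ₑ + ‖φ x - f (x, t)‖ₑ) := by
          refine lintegral_mono fun x => ?_
          have := enorm_add_le (f (x, t)) (φ x - f (x, t))
          rwa [add_sub_cancel] at this
      _ = (∫⁻ x in cube a ρ, ‖f (x, t)‖ₑ) + ∫⁻ x in cube a ρ, ‖φ x - f (x, t)‖ₑ :=
          lintegral_add_left (by fun_prop : Measurable fun x => ‖f (x, t)‖ₑ) _
      _ ≤ _ := by gcongr; exact ht ht01
  calc ∫⁻ x in cube a ρ, ‖φ x‖ₑ = ∫⁻ _ in Ioo (0 : ℝ) 1, ∫⁻ x in cube a ρ, ‖φ x‖ₑ := by simp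
    _ ≤ ∫⁻ t in Ioo (0 : ℝ) 1, ((∫⁻ x in cube a ρ, ‖f (x, t)‖ₑ) + I) :=
        setLIntegral_mono_ae' measurableSet_Ioo key
    _ = _ := by
        rw [lintegral_add_right _ measurable_const, setLIntegral_prod_Ioo_symm hfm.enorm]
        simp

theorem sum_smul_dirX (h : Fin n → ℝ) : ∑ i, h i • (dirX i : Space n) = (h, 0) := by
  refine Prod.ext ?_ ?_
  · rw [Prod.fst_sum]
    ext j
    simp [dirX, Finset.sum_apply, Pi.single_apply]
  · rw [Prod.snd_sum]
    simp [dirX]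

/-- A Poincaré inequality on horizontal slices. -/
theorem lintegral_lintegral_sub_le {a : Fin n → ℝ} {ρ r : ℝ}
    (h : ∀ i, HasWeakDeriv (cube a ρ ×ˢ Ioo 0 r) (dirX i) f (G i)) (hfm : Measurable f)
    (hGm : ∀ i, Measurable (G i)) (hf : IntegrableOn f (cube a ρ ×ˢ Ioo 0 r))
    (hG : ∀ i, IntegrableOn (G i) (cube a ρ ×ˢ Ioo 0 r)) :
    ∫⁻ p in cube a ρ ×ˢ Ioo 0 r, ∫⁻ y in cube a ρ, ‖f (y, p.2) - f p‖ₑ ≤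
      ENNReal.ofReal (2 * ρ) ^ n *
        (ENNReal.ofReal ρ * ∑ i, ∫⁻ p in cube a ρ ×ˢ Ioo 0 r, ‖G i p‖ₑ) := by
  set Q := cube a ρ with hQ
  set V : Set (Space n) := Q ×ˢ Ioo 0 r with hV
  have hQo : IsOpen Q := isOpen_cube a ρ
  have hVo : IsOpen V := hQo.prod isOpen_Ioo
  set M := ENNReal.ofReal ρ * ∑ i, ∫⁻ p in V, ‖G i p‖ₑ
  -- With `y = x + h'`, only displacements in `K` join two points of `Q`. For fixed `h'` the
  -- difference is the integral of a directional derivative whose coefficients have modulus at most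
  -- `ρ`. The volume of `K` gives the factor `(2 * ρ) ^ n`.
  let K : Set (Fin n → ℝ) := cube (fun _ => -ρ) (2 * ρ)
  have hbound : ∀ h' : Fin n → ℝ,
      ∫⁻ p in V, Q.indicator (fun y => ‖f (y, p.2) - f p‖ₑ) (p.1 + h')
        ≤ K.indicator (fun _ => M) h' := by
    intro h'
    let U : Set (Space n) := V ∩ {p | p.1 + h' ∈ Q}
    have hUo : IsOpen U := hVo.inter (hQo.preimage (by fun_prop))
    have e1 : ∫⁻ p in V, Q.indicator (fun y => ‖f (y, p.2) - f p‖ₑ) (p.1 + h')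
        = ∫⁻ p in U, ‖f (p + (h', 0)) - f p‖ₑ := by
      rw [← lintegral_indicator hVo.measurableSet, ← lintegral_indicator hUo.measurableSet]
      congr 1; ext p
      by_cases hp : p ∈ V <;> by_cases hp' : p.1 + h' ∈ Q
      · rw [indicator_of_mem hp, indicator_of_mem hp', indicator_of_mem (show p ∈ U from ⟨hp, hp'⟩)]
        congr 3
        exact Prod.ext rfl (add_zero _).symm
      · rw [indicator_of_mem hp, indicator_of_notMem hp',
          indicator_of_notMem fun hU : p ∈ U => hp' hU.2]
      · rw [indicator_of_notMem hp, indicator_of_notMem fun hU : p ∈ U => hp hU.1]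
      · rw [indicator_of_notMem hp, indicator_of_notMem fun hU : p ∈ U => hp hU.1]
    rw [e1]
    by_cases hh : h' ∈ K
    · rw [indicator_of_mem hh]
      have hw := HasWeakDeriv.sum_smul hf hG h h'
      rw [sum_smul_dirX] at hw
      have hgm : Measurable fun p => ∑ i, h' i * G i p := by fun_prop
      have hgi : IntegrableOn (fun p => ∑ i, h' i * G i p) V :=
        integrable_finsetSum _ fun i _ => (hG i).const_mul (h' i)
      refine (hw.lintegral_sub_le hVo hfm hgm hf hgi hUo ?_).trans ?_
      · rintro ⟨x, t⟩ ⟨⟨hx, ht⟩, hx'⟩ s ⟨hs0, hs1⟩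
        refine ⟨fun i => ?_, by simpa using ht⟩
        exact (convex_Ioo (a i) (a i + ρ)).add_smul_mem (hx i) (hx' i) ⟨hs0, hs1⟩
      · calc ∫⁻ p in V, ‖∑ i, h' i * G i p‖ₑ
            ≤ ∫⁻ p in V, ∑ i, ENNReal.ofReal ρ * ‖G i p‖ₑ := by
              refine lintegral_mono fun p => (enorm_sum_le _ _).trans ?_
              refine Finset.sum_le_sum fun i _ => ?_
              rw [enorm_mul]
              gcongr
              rw [Real.enorm_eq_ofReal_abs]
              refine ENNReal.ofReal_le_ofReal (abs_le.2 ?_)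
              have := hh i
              constructor <;> linarith [this.1, this.2]
          _ = M := by
              simp only [M]
              rw [lintegral_finsetSum _ fun i _ => by fun_prop, Finset.mul_sum]
              refine Finset.sum_congr rfl fun i _ => lintegral_const_mul _ (hGm i).enorm
    · rw [indicator_of_notMem hh]
      have hU : U = ∅ := by
        rw [eq_empty_iff_forall_notMem]
        rintro ⟨x, t⟩ ⟨⟨hx, -⟩, hx'⟩
        refine hh fun i => ?_
        have h1 := hx i
        have h2 := hx' i
        simp only [Pi.add_apply] at h2
        constructor <;> linarith [h1.1, h1.2, h2.1, h2.2]
      rw [hU]; simp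
  have hm : Measurable fun z : Space n × (Fin n → ℝ) =>
      Q.indicator (fun y => ‖f (y, z.1.2) - f z.1‖ₑ) (z.1.1 + z.2) := by
    have h1 : Measurable fun z : Space n × (Fin n → ℝ) => ‖f (z.1.1 + z.2, z.1.2) - f z.1‖ₑ := by
      fun_prop
    exact h1.indicator ((by fun_prop : Measurable fun z : Space n × (Fin n → ℝ) =>
      z.1.1 + z.2) hQo.measurableSet)
  calc ∫⁻ p in V, ∫⁻ y in Q, ‖f (y, p.2) - f p‖ₑ
      = ∫⁻ p in V, ∫⁻ h', Q.indicator (fun y => ‖f (y, p.2) - f p‖ₑ) (p.1 + h') := by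
        refine lintegral_congr fun p => ?_
        rw [lintegral_add_left_eq_self
          (fun y => Q.indicator (fun y => ‖f (y, p.2) - f p‖ₑ) y) p.1,
          lintegral_indicator hQo.measurableSet]
    _ = ∫⁻ h', ∫⁻ p in V, Q.indicator (fun y => ‖f (y, p.2) - f p‖ₑ) (p.1 + h') :=
        lintegral_lintegral_swap hm.aemeasurable
    _ ≤ ∫⁻ h', K.indicator (fun _ => M) h' := lintegral_mono hbound
    _ = ENNReal.ofReal (2 * ρ) ^ n * M := by
        rw [lintegral_indicator (measurableSet_cube _ _), setLIntegral_const, volume_cube, mul_comm]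

theorem integrableOn_cube {φ : (Fin n → ℝ) → ℝ} (hφ : LocallyIntegrable φ) (a : Fin n → ℝ)
    (ρ : ℝ) : IntegrableOn φ (cube a ρ) := by
  refine (hφ.integrableOn_isCompact (isCompact_univ_pi fun i =>
    isCompact_Icc (a := a i) (b := a i + ρ))).mono_set ?_
  rw [cube_eq_pi]
  exact Set.pi_mono fun i _ => Ioo_subset_Icc_self

theorem enorm_setAverage_sub_le {α : Type*} [MeasurableSpace α] {μ : Measure α} {s : Set α}
    (h0 : μ s ≠ 0) (ht : μ s ≠ ∞) {φ : α → ℝ} (hφ : IntegrableOn φ s μ) (c : ℝ) :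
    ‖(⨍ y in s, φ y ∂μ) - c‖ₑ ≤ (μ s)⁻¹ * ∫⁻ y in s, ‖φ y - c‖ₑ ∂μ := by
  have hfin : IsFiniteMeasure (μ.restrict s) := ⟨by simpa using ht.lt_top⟩
  have hne : NeZero (μ.restrict s) := ⟨by rwa [Ne, Measure.restrict_eq_zero]⟩
  have e : (⨍ y in s, φ y ∂μ) - c = ⨍ y in s, (φ y - c) ∂μ := by
    rw [average, average, integral_sub hφ.to_average (integrable_const c)]
    simp [Measure.real, inv_mul_cancel₀ (ENNReal.toReal_ne_zero.2 ⟨h0, ht⟩)]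
  rw [e, average]
  refine (enorm_integral_le_lintegral_enorm _).trans_eq ?_
  rw [lintegral_smul_measure, Measure.restrict_apply_univ, smul_eq_mul]

/-- By Jensen it suffices to bound the double integral `L` of `|φ y - φ x|`. Both values are
replaced by those of `f` on a slice, at the cost of the vertical derivative, and the slice term is
handled by Poincaré after averaging over heights. The condition `ρ ≤ 2 * r` fits a cube enlarged by
a factor of at most 2. -/
theorem IsTrace.lintegral_average_sub_le {φ : (Fin n → ℝ) → ℝ} (hφ : IsTrace f φ)
    {a : Fin n → ℝ} {ρ r : ℝ} (hρ : 0 < ρ) (hr : 0 < r) (hρr : ρ ≤ 2 * r)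
    (hX : ∀ i, HasWeakDeriv (cube a ρ ×ˢ Ioo 0 r) (dirX i) f (G i))
    (hT : HasWeakDeriv (cube a ρ ×ˢ Ioo 0 r) (dirT n) f F) (hfm : Measurable f)
    (hFm : Measurable F) (hGm : ∀ i, Measurable (G i))
    (hf : IntegrableOn f (cube a ρ ×ˢ Ioo 0 r)) (hF : IntegrableOn F (cube a ρ ×ˢ Ioo 0 r))
    (hG : ∀ i, IntegrableOn (G i) (cube a ρ ×ˢ Ioo 0 r)) :
    ∫⁻ x in cube a ρ, ‖(⨍ y in cube a ρ, φ y) - φ x‖ₑ ≤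
      2 ^ (n + 1) * ∫⁻ p in cube a ρ ×ˢ Ioo 0 r, (∑ i, ‖G i p‖ₑ + ‖F p‖ₑ) := by
  set Q := cube a ρ with hQ
  set V : Set (Space n) := Q ×ˢ Ioo 0 r with hV
  have hQ0 : volume Q ≠ 0 := by
    rw [hQ, volume_cube]
    exact pow_ne_zero _ (by simpa using hρ)
  have hQt : volume Q ≠ ∞ := volume_cube_ne_top a ρ
  set I := ∫⁻ p in V, ‖F p‖ₑ
  set L := ∫⁻ x in Q, ∫⁻ y in Q, ‖φ y - φ x‖ₑ with hL
  have hH : Measurable fun p : Space n => ∫⁻ y in Q, ‖f (y, p.2) - f p‖ₑ :=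
    Measurable.lintegral_prod_right' (f := fun z : Space n × (Fin n → ℝ) =>
      ‖f (z.2, z.1.2) - f z.1‖ₑ) (by fun_prop)
  have hslice : ∀ᵐ t : ℝ, t ∈ Ioo 0 r →
      L ≤ 2 * (volume Q * I) + ∫⁻ x in Q, ∫⁻ y in Q, ‖f (y, t) - f (x, t)‖ₑ := by
    filter_upwards [hφ.ae_lintegral_sub_le hρ hT hfm hFm hf hF] with t ht htr
    have hHt : Measurable fun x => ∫⁻ y in Q, ‖f (y, t) - f (x, t)‖ₑ :=
      hH.comp (by fun_prop : Measurable fun x : Fin n → ℝ => (x, t))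
    calc L ≤ ∫⁻ x in Q, ((I + ∫⁻ y in Q, ‖f (y, t) - f (x, t)‖ₑ)
            + ‖φ x - f (x, t)‖ₑ * volume Q) := by
          refine lintegral_mono fun x => ?_
          calc ∫⁻ y in Q, ‖φ y - φ x‖ₑ
              ≤ ∫⁻ y in Q, (‖φ y - f (y, t)‖ₑ
                  + (‖f (y, t) - f (x, t)‖ₑ + ‖φ x - f (x, t)‖ₑ)) := by
                refine lintegral_mono fun y => ?_
                have h1 := enorm_add_le (φ y - f (y, t)) (f (y, t) - φ x)
                have h2 := enorm_sub_le (a := f (y, t) - f (x, t)) (b := φ x - f (x, t))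
                rw [sub_add_sub_cancel] at h1
                rw [sub_sub_sub_cancel_right] at h2
                exact h1.trans (add_le_add_right h2 _)
            _ = (∫⁻ y in Q, ‖φ y - f (y, t)‖ₑ)
                  + ((∫⁻ y in Q, ‖f (y, t) - f (x, t)‖ₑ) + ‖φ x - f (x, t)‖ₑ * volume Q) := by
                rw [lintegral_add_right _ (by fun_prop), lintegral_add_right _ (by fun_prop),
                  setLIntegral_const]
            _ ≤ _ := by rw [add_assoc]; gcongr; exact ht htr
      _ = (volume Q * I + ∫⁻ x in Q, ∫⁻ y in Q, ‖f (y, t) - f (x, t)‖ₑ)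
            + (∫⁻ x in Q, ‖φ x - f (x, t)‖ₑ) * volume Q := by
          have hm : Measurable fun x => I + ∫⁻ y in Q, ‖f (y, t) - f (x, t)‖ₑ :=
            measurable_const.add hHt
          rw [lintegral_add_left hm, lintegral_add_left measurable_const,
            setLIntegral_const, lintegral_mul_const' _ _ hQt, mul_comm I]
      _ ≤ (volume Q * I + ∫⁻ x in Q, ∫⁻ y in Q, ‖f (y, t) - f (x, t)‖ₑ) + I * volume Q := by
          gcongr; exact ht htr
      _ = _ := by ring
  -- Poincaré supplies `(2 * ρ) ^ n * ρ`, which is at most `2 ^ (n + 1) * r` times the volume of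
  -- `Q`. The factor `r` then cancels against the averaging over heights.
  have hmean : ENNReal.ofReal r * L ≤ ENNReal.ofReal r *
      (volume Q * (2 ^ (n + 1) * ∫⁻ p in V, (∑ i, ‖G i p‖ₑ + ‖F p‖ₑ))) := by
    have hS : ∫⁻ p in V, (∑ i, ‖G i p‖ₑ + ‖F p‖ₑ) = (∑ i, ∫⁻ p in V, ‖G i p‖ₑ) + I := by
      rw [lintegral_add_right _ hFm.enorm, lintegral_finsetSum _ fun i _ => (hGm i).enorm]
    calc ENNReal.ofReal r * L = ∫⁻ _ in Ioo 0 r, L := by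
          rw [setLIntegral_const, Real.volume_Ioo, sub_zero, mul_comm]
      _ ≤ ∫⁻ t in Ioo 0 r, (2 * (volume Q * I)
            + ∫⁻ x in Q, ∫⁻ y in Q, ‖f (y, t) - f (x, t)‖ₑ) :=
          setLIntegral_mono_ae' measurableSet_Ioo hslice
      _ = ENNReal.ofReal r * (2 * (volume Q * I))
            + ∫⁻ p in V, ∫⁻ y in Q, ‖f (y, p.2) - f p‖ₑ := by
          rw [lintegral_add_left measurable_const, setLIntegral_const, Real.volume_Ioo, sub_zero,
            mul_comm (ENNReal.ofReal r), setLIntegral_prod_Ioo_symm hH]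
      _ ≤ ENNReal.ofReal r * (2 * (volume Q * I)) + ENNReal.ofReal (2 * ρ) ^ n *
            (ENNReal.ofReal ρ * ∑ i, ∫⁻ p in V, ‖G i p‖ₑ) :=
          add_le_add_right (lintegral_lintegral_sub_le hX hfm hGm hf hG) _
      _ ≤ ENNReal.ofReal r * (2 ^ (n + 1) * (volume Q * I)) + (2 ^ n * volume Q) *
            (2 * ENNReal.ofReal r * ∑ i, ∫⁻ p in V, ‖G i p‖ₑ) := by
          have h1 : ENNReal.ofReal ρ ≤ 2 * ENNReal.ofReal r := by
            refine (ENNReal.ofReal_le_ofReal hρr).trans_eq ?_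
            rw [ENNReal.ofReal_mul (by norm_num)]; simp
          have h2 : ENNReal.ofReal (2 * ρ) ^ n = 2 ^ n * volume Q := by
            rw [ENNReal.ofReal_mul (by norm_num), mul_pow, hQ, volume_cube]; simp
          have h3 : (2 : ℝ≥0∞) ≤ 2 ^ (n + 1) :=
            le_self_pow₀ (by norm_num) (by omega)
          rw [h2]
          gcongr
      _ = _ := by rw [hS, pow_succ]; ring
  have hLle := (ENNReal.mul_le_mul_iff_right (by simpa using hr) ENNReal.ofReal_ne_top).1 hmean
  calc ∫⁻ x in Q, ‖(⨍ y in Q, φ y) - φ x‖ₑ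
      ≤ ∫⁻ x in Q, (volume Q)⁻¹ * ∫⁻ y in Q, ‖φ y - φ x‖ₑ :=
        lintegral_mono fun x =>
          enorm_setAverage_sub_le hQ0 hQt (integrableOn_cube hφ.1 a ρ) (φ x)
    _ = (volume Q)⁻¹ * L := lintegral_const_mul' _ _ (ENNReal.inv_ne_top.2 hQ0)
    _ ≤ (volume Q)⁻¹ * (volume Q * (2 ^ (n + 1) * ∫⁻ p in V, (∑ i, ‖G i p‖ₑ + ‖F p‖ₑ))) := by
        gcongr
    _ = _ := by rw [← mul_assoc, ENNReal.inv_mul_cancel hQ0 hQt, one_mul]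

end TraceEstimates

/-! ### Weights -/

section Weights

variable {n : ℕ} {γ : Space n → ℝ} {C : ℝ}

theorem isOpen_spaceCube (a : Fin n → ℝ) (b r : ℝ) : IsOpen (spaceCube a b r) :=
  (isOpen_cube a r).prod isOpen_Ioo

theorem volume_spaceCube (a : Fin n → ℝ) (b r : ℝ) :
    volume (spaceCube a b r) = ENNReal.ofReal r ^ (n + 1) := by
  rw [spaceCube, volume_prod_Ioo, volume_cube, add_sub_cancel_left, pow_succ]

theorem volume_spaceCube_ne_zero (a : Fin n → ℝ) (b : ℝ) {r : ℝ} (hr : 0 < r) :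
    volume (spaceCube a b r) ≠ 0 := by
  rw [volume_spaceCube]
  exact pow_ne_zero _ (by simpa using hr)

theorem volume_spaceCube_ne_top (a : Fin n → ℝ) (b r : ℝ) : volume (spaceCube a b r) ≠ ∞ := by
  rw [volume_spaceCube]; exact ENNReal.pow_ne_top ENNReal.ofReal_ne_top

theorem real_volume_spaceCube (a : Fin n → ℝ) (b : ℝ) {r : ℝ} (hr : 0 ≤ r) :
    volume.real (spaceCube a b r) = r ^ (n + 1) := by
  rw [Measure.real, volume_spaceCube, ENNReal.toReal_pow, ENNReal.toReal_ofReal hr]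

theorem integrableOn_spaceCube (h : LocallyIntegrable γ) (a : Fin n → ℝ) (b r : ℝ) :
    IntegrableOn γ (spaceCube a b r) := by
  refine (h.integrableOn_isCompact ((isCompact_univ_pi fun i =>
    isCompact_Icc (a := a i) (b := a i + r)).prod (isCompact_Icc (a := b) (b := b + r)))).mono_set ?_
  refine prod_mono ?_ Ioo_subset_Icc_self
  rw [cube_eq_pi]
  exact Set.pi_mono fun i _ => Ioo_subset_Icc_self

theorem IsWeight.average_pos (h : IsWeight γ) (a : Fin n → ℝ) (b : ℝ) {r : ℝ} (hr : 0 < r) :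
    0 < ⨍ p in spaceCube a b r, γ p := by
  have h0 := volume_spaceCube_ne_zero a b hr
  rw [setAverage_eq, smul_eq_mul]
  refine mul_pos (inv_pos.2 (ENNReal.toReal_pos h0 (volume_spaceCube_ne_top a b r))) ?_
  rw [setIntegral_pos_iff_support_of_nonneg_ae (ae_restrict_of_ae (h.2.mono fun p hp => hp.le))
    (integrableOn_spaceCube h.1 a b r)]
  refine pos_iff_ne_zero.2 fun hz => h0 ?_
  rw [← hz]
  refine measure_congr ?_
  filter_upwards [h.2] with p hp
  exact propext ⟨fun hq => ⟨hp.ne', hq⟩, fun hq => hq.2⟩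

/-- The mean value over a small cube is almost everywhere bounded by the weight. -/
theorem IsA1Loc.ae_average_le (h : IsA1Loc γ C) (a : Fin n → ℝ) (b : ℝ) {r : ℝ} (hr : 0 < r)
    (hr1 : r ≤ 1) : ∀ᵐ p, p ∈ spaceCube a b r →
      (⨍ q in spaceCube a b r, γ q) ≤ max C 1 * γ p := by
  set S := spaceCube a b r
  have h0 : volume S ≠ 0 := volume_spaceCube_ne_zero a b hr
  have hpos : ∀ᵐ p ∂volume.restrict S, 0 ≤ γ p := ae_restrict_of_ae (h.1.2.mono fun p hp => hp.le)
  have hbdd : IsBoundedUnder (· ≥ ·) (ae (volume.restrict S)) γ := ⟨0, hpos⟩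
  -- For a real-valued `γ` the lower bound on `essInf` requires this: `γ` is at most its mean on a
  -- set of positive measure. Nonnegativity of `essInf` then allows `C` to be replaced by `max C 1`.
  have hcob : IsCoboundedUnder (· ≥ ·) (ae (volume.restrict S)) γ := by
    refine ⟨⨍ q in S, γ q, fun x hx => ?_⟩
    have hfreq : ∃ᶠ p in ae (volume.restrict S), γ p ≤ ⨍ q in S, γ q := by
      have := measure_le_setAverage_pos h0 (volume_spaceCube_ne_top a b r)
        (integrableOn_spaceCube h.1.1 a b r)
      rw [frequently_ae_iff, Measure.restrict_apply' (isOpen_spaceCube a b r).measurableSet,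
        inter_comm]
      exact this.ne'
    obtain ⟨p, hp1, hp2⟩ := (hfreq.and_eventually hx).exists
    exact le_trans hp2 hp1
  have hinf : 0 ≤ essInf γ (volume.restrict S) := le_liminf_of_le hcob hpos
  rw [← ae_restrict_iff' (isOpen_spaceCube a b r).measurableSet]
  filter_upwards [ae_essInf_le hbdd] with p hp
  have hC : 0 ≤ max C 1 := le_max_of_le_right zero_le_one
  calc (⨍ q in S, γ q) ≤ C * essInf γ (volume.restrict S) := h.2 a b r hr hr1
    _ ≤ max C 1 * essInf γ (volume.restrict S) := by gcongr; exact le_max_left _ _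
    _ ≤ max C 1 * γ p := by gcongr

theorem setIntegral_eq_volume_mul_average {S : Set (Space n)} (h0 : volume S ≠ 0)
    (ht : volume S ≠ ∞) : ∫ p in S, γ p = volume.real S * ⨍ p in S, γ p := by
  have h : volume.real S ≠ 0 := ENNReal.toReal_ne_zero.2 ⟨h0, ht⟩
  rw [setAverage_eq, smul_eq_mul, mul_inv_cancel_left₀ h]

/-- Comparison of mean values over cubes with a common subcube. -/
theorem IsA1Loc.average_le_average (h : IsA1Loc γ C) {a a' c : Fin n → ℝ} {b b' d r r' ρ : ℝ}
    (hr : 0 < r) (hr1 : r ≤ 1) (hρ : 0 < ρ) (h1 : spaceCube c d ρ ⊆ spaceCube a b r)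
    (h2 : spaceCube c d ρ ⊆ spaceCube a' b' r') (hr' : 0 < r') {κ : ℝ}
    (hκ : r' ^ (n + 1) ≤ κ * ρ ^ (n + 1)) :
    (⨍ p in spaceCube a b r, γ p) ≤ max C 1 * κ * ⨍ p in spaceCube a' b' r', γ p := by
  set A := ⨍ p in spaceCube a b r, γ p
  set A' := ⨍ p in spaceCube a' b' r', γ p
  have hA' : 0 < A' := h.1.average_pos a' b' hr'
  have hC : 0 ≤ max C 1 := le_max_of_le_right zero_le_one
  have hi := integrableOn_spaceCube h.1.1 c d ρ
  have key : ρ ^ (n + 1) * A ≤ max C 1 * (r' ^ (n + 1) * A') := by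
    calc ρ ^ (n + 1) * A = ∫ _ in spaceCube c d ρ, A := by
          rw [setIntegral_const, real_volume_spaceCube c d hρ.le, smul_eq_mul]
      _ ≤ ∫ p in spaceCube c d ρ, max C 1 * γ p := by
          refine setIntegral_mono_on_ae (integrableOn_const (volume_spaceCube_ne_top c d ρ))
            (hi.const_mul _) (isOpen_spaceCube c d ρ).measurableSet ?_
          filter_upwards [h.ae_average_le a b hr hr1] with p hp hpS
          exact hp (h1 hpS)
      _ = max C 1 * ∫ p in spaceCube c d ρ, γ p := integral_const_mul _ _
      _ ≤ max C 1 * ∫ p in spaceCube a' b' r', γ p := by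
          refine mul_le_mul_of_nonneg_left (setIntegral_mono_set
            (integrableOn_spaceCube h.1.1 a' b' r')
            (ae_restrict_of_ae (h.1.2.mono fun p hp => hp.le)) h2.eventuallyLE) hC
      _ = max C 1 * (r' ^ (n + 1) * A') := by
          rw [setIntegral_eq_volume_mul_average (volume_spaceCube_ne_zero a' b' hr')
            (volume_spaceCube_ne_top a' b' r'), real_volume_spaceCube a' b' hr'.le]
  have hp : (0 : ℝ) < ρ ^ (n + 1) := by positivity
  refine le_of_mul_le_mul_left (key.trans ?_) hp
  calc max C 1 * (r' ^ (n + 1) * A') ≤ max C 1 * (κ * ρ ^ (n + 1) * A') := by gcongr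
    _ = _ := by ring

/-- Comparison of mean values over cubes translated by half their side length. -/
theorem IsA1Loc.average_le_average_translate (h : IsA1Loc γ C) {a a' : Fin n → ℝ} {r : ℝ}
    (hr : 0 < r) (hr1 : r ≤ 1) (ha : ∀ i, |a i - a' i| ≤ r / 2) :
    (⨍ p in spaceCube a 0 r, γ p) ≤
      max C 1 * 2 ^ (n + 1) * ⨍ p in spaceCube a' 0 r, γ p := by
  have hI : Ioo (0 : ℝ) (0 + r / 2) ⊆ Ioo 0 (0 + r) := Ioo_subset_Ioo_right (by linarith)
  -- Cubes shifted by at most half a side share a subcube of half the side, starting at the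
  -- coordinatewise maximum of the corners. The volume ratio is `2 ^ (n + 1)`.
  refine h.average_le_average (c := fun i => max (a i) (a' i)) (d := 0) (ρ := r / 2) hr hr1
    (by linarith) (prod_mono ?_ hI) (prod_mono ?_ hI) hr (le_of_eq ?_)
  · intro x hx i
    have h1 := hx i
    have h2 := abs_le.1 (ha i)
    have h3 : max (a i) (a' i) ≤ a i + r / 2 := max_le (by linarith) (by linarith)
    exact ⟨(le_max_left _ _).trans_lt h1.1, by linarith⟩
  · intro x hx i
    have h1 := hx i
    have h2 := abs_le.1 (ha i)
    have h3 : max (a i) (a' i) ≤ a' i + r / 2 := max_le (by linarith) (by linarith)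
    exact ⟨(le_max_right _ _).trans_lt h1.1, by linarith⟩
  · rw [← mul_pow]; congr 1; ring

/-- The lower corner of a dyadic cube. -/
noncomputable def corner (α : DyadicIndex n) (i : Fin n) : ℝ := (α.2 i : ℝ) / 2 ^ α.1

theorem dyadicCube_eq_cube (α : DyadicIndex n) : dyadicCube α = cube (corner α) (side α) := by
  ext x
  simp only [dyadicCube, cube, corner, side, mem_ofPred_eq, add_div, one_div]

theorem dyadicBox_eq_spaceCube (α : DyadicIndex n) :
    dyadicCube α ×ˢ Ioo 0 (side α) = spaceCube (corner α) 0 (side α) := by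
  rw [spaceCube, dyadicCube_eq_cube, zero_add]

theorem meanWeight_eq (γ : Space n → ℝ) (α : DyadicIndex n) :
    meanWeight γ α = ⨍ p in spaceCube (corner α) 0 (side α), γ p := by
  rw [meanWeight, dyadicBox_eq_spaceCube]

theorem spaceCube_subset_ancestor {α : DyadicIndex n} {j : ℕ} (hj : j ≤ α.1) :
    spaceCube (corner α) 0 (side α)
      ⊆ spaceCube (corner (ancestor j α)) 0 (side (ancestor j α)) := by
  rw [← dyadicBox_eq_spaceCube, ← dyadicBox_eq_spaceCube]
  refine prod_mono (dyadicCube_subset_ancestor hj) (Ioo_subset_Ioo_right ?_)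
  exact inv_anti₀ (by positivity) (pow_le_pow_right₀ (by norm_num) hj)

/-- The comparison constant for the mean values of a weight in `A₁^loc`. -/
noncomputable def comparisonConstant (n : ℕ) (C : ℝ) : ℝ := (max C 1 * 2 ^ (n + 1)) ^ 2

theorem le_comparisonConstant (n : ℕ) (C : ℝ) :
    1 ≤ comparisonConstant n C ∧ max C 1 ≤ comparisonConstant n C ∧
      2 ^ (n + 1) ≤ comparisonConstant n C ∧
      max C 1 * 2 ^ (n + 1) * max C 1 ≤ comparisonConstant n C := by
  have h1 : 1 ≤ max C 1 := le_max_right _ _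
  have h2 : (1 : ℝ) ≤ 2 ^ (n + 1) := one_le_pow₀ (by norm_num)
  have h3 : 1 ≤ max C 1 * 2 ^ (n + 1) := one_le_mul_of_one_le_of_one_le h1 h2
  have h4 : max C 1 ≤ max C 1 * 2 ^ (n + 1) := le_mul_of_one_le_right (by linarith) h2
  have h5 : (2 : ℝ) ^ (n + 1) ≤ max C 1 * 2 ^ (n + 1) :=
    le_mul_of_one_le_left (by positivity) h1
  unfold comparisonConstant
  refine ⟨one_le_pow₀ h3, h4.trans (le_self_pow₀ h3 (by norm_num)),
    h5.trans (le_self_pow₀ h3 (by norm_num)), ?_⟩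
  rw [pow_two]
  gcongr

/-- The mean over a cube is bounded almost everywhere by a multiple of `γ`, hence by the mean over
any subcube. Conversely, positivity of `γ` bounds the mean over a child by `2 ^ (n + 1)` times that
over the parent. Adjacent cubes are linked by half-side translations. -/
theorem IsA1Loc.isSlowlyVarying (h : IsA1Loc γ C) :
    IsSlowlyVarying (meanWeight γ) (comparisonConstant n C) := by
  obtain ⟨hD1, hDC, hD2, -⟩ := le_comparisonConstant n C
  have hpos : ∀ α : DyadicIndex n, 0 < meanWeight γ α := fun α => by
    rw [meanWeight_eq]; exact h.1.average_pos _ _ (side_pos α)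
  refine ⟨hD1, hpos, ?_, ?_, ?_⟩
  · intro α j hj
    have := h.average_le_average (κ := 1) (side_pos (ancestor j α)) (side_le_one _) (side_pos α)
      (spaceCube_subset_ancestor hj) subset_rfl (side_pos α) (by rw [one_mul])
    rw [← meanWeight_eq, ← meanWeight_eq, mul_one] at this
    refine this.trans ?_
    have := hpos α
    gcongr
  · intro α j hj
    have hs : side (ancestor j α) = 2 * side α := by
      simp only [side, ancestor_fst, hj, pow_succ, mul_inv]; ring
    have hsub := spaceCube_subset_ancestor (α := α) (j := j) (by omega)
    have h1 := setIntegral_mono_set (integrableOn_spaceCube h.1.1 _ 0 (side (ancestor j α)))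
      (ae_restrict_of_ae (h.1.2.mono fun p hp => hp.le)) hsub.eventuallyLE
    rw [setIntegral_eq_volume_mul_average (volume_spaceCube_ne_zero _ _ (side_pos _))
        (volume_spaceCube_ne_top _ _ _),
      setIntegral_eq_volume_mul_average (volume_spaceCube_ne_zero _ _ (side_pos _))
        (volume_spaceCube_ne_top _ _ _), ← meanWeight_eq, ← meanWeight_eq,
      real_volume_spaceCube _ _ (side_pos _).le, real_volume_spaceCube _ _ (side_pos _).le, hs,
      mul_pow] at h1
    have h2 : meanWeight γ α ≤ 2 ^ (n + 1) * meanWeight γ (ancestor j α) := by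
      have hp : 0 < side α ^ (n + 1) := pow_pos (side_pos α) _
      refine le_of_mul_le_mul_left (h1.trans_eq ?_) hp
      ring
    refine h2.trans ?_
    have := hpos (ancestor j α)
    gcongr
  · intro α β hadj
    have hs : side β = side α := by rw [side, side, hadj.1]
    -- Adjacent cubes may be disjoint, so the comparison goes through the cube halfway between them.
    -- These two translations account for the square in `comparisonConstant`.
    let c : Fin n → ℝ := fun i => (corner α i + corner β i) / 2
    have hc : ∀ i, |corner α i - corner β i| ≤ side α := by
      intro i
      have h1 : |((α.2 i : ℝ) - β.2 i)| ≤ 1 := by exact_mod_cast hadj.2 i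
      rw [corner, corner, ← hadj.1, ← sub_div, abs_div, abs_of_pos (by positivity : (0 : ℝ) < 2 ^ α.1),
        side, div_eq_mul_inv]
      exact mul_le_of_le_one_left (by positivity) h1
    have h1 := h.average_le_average_translate (a := corner α) (a' := c) (side_pos α)
      (side_le_one α) fun i => by
        have : corner α i - c i = (corner α i - corner β i) / 2 := by simp only [c]; ring
        rw [this, abs_div, abs_two]
        linarith [hc i]
    have h2 := h.average_le_average_translate (a := c) (a' := corner β) (side_pos α)
      (side_le_one α) fun i => by
        have : c i - corner β i = (corner α i - corner β i) / 2 := by simp only [c]; ring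
        rw [this, abs_div, abs_two]
        linarith [hc i]
    rw [← meanWeight_eq] at h1
    rw [← hs, ← meanWeight_eq, hs] at h2
    calc meanWeight γ α ≤ max C 1 * 2 ^ (n + 1) * _ := h1
      _ ≤ max C 1 * 2 ^ (n + 1) * (max C 1 * 2 ^ (n + 1) * meanWeight γ β) := by
          gcongr
      _ = comparisonConstant n C * meanWeight γ β := by rw [comparisonConstant]; ring

/-- On the boxes over enlarged cubes the mean value is bounded by the weight. -/
theorem IsA1Loc.ae_meanWeight_le (h : IsA1Loc γ C) (k : ℕ) :
    ∀ᵐ p : Space n, ∀ α : DyadicIndex n, p ∈ enlargedCube k α ×ˢ Ioo 0 (side α) →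
      meanWeight γ α ≤ comparisonConstant n C * γ p := by
  refine ae_all_iff.2 fun α => ?_
  -- Translates of the box by `-1`, `0` or `1` half-sides in each coordinate cover the box over the
  -- enlarged cube, since the margin is at most half a side.
  let c : (Fin n → ℤ) → Fin n → ℝ := fun e i => corner α i + e i * (side α / 2)
  have hae : ∀ᵐ p : Space n, ∀ e : Fin n → ℤ, (∀ i, |e i| ≤ 1) → p ∈ spaceCube (c e) 0 (side α) →
      meanWeight γ α ≤ comparisonConstant n C * γ p := by
    refine ae_all_iff.2 fun e => ?_
    filter_upwards [h.ae_average_le (c e) 0 (side_pos α) (side_le_one α), h.1.2] with p hp hp0 he hpe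
    have h1 := h.average_le_average_translate (a := corner α) (a' := c e) (side_pos α)
      (side_le_one α) fun i => by
        have he' : |(e i : ℝ)| ≤ 1 := by exact_mod_cast he i
        have hs := side_pos α
        simp only [c]
        rw [sub_add_cancel_left, abs_neg, abs_mul, abs_of_pos (by linarith : 0 < side α / 2)]
        exact mul_le_of_le_one_left (by linarith) he'
    rw [← meanWeight_eq] at h1
    calc meanWeight γ α ≤ max C 1 * 2 ^ (n + 1) * _ := h1
      _ ≤ max C 1 * 2 ^ (n + 1) * (max C 1 * γ p) := by gcongr; exact hp hpe
      _ = max C 1 * 2 ^ (n + 1) * max C 1 * γ p := by ring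
      _ ≤ comparisonConstant n C * γ p := by
          gcongr; exact (le_comparisonConstant n C).2.2.2
  filter_upwards [hae] with p hp hpα
  have hcoord : ∀ i, ∃ z : ℤ, |z| ≤ 1 ∧ corner α i + z * (side α / 2) < p.1 i ∧
      p.1 i < corner α i + z * (side α / 2) + side α := by
    intro i
    have h1 := hpα.1 i
    have h3 : (1 + ((2 : ℝ) ^ k)⁻¹) * side α / 2 ≤ side α := by
      have := half_enlargement_le k
      nlinarith [side_pos α]
    have h4 : ((α.2 i : ℝ) + 1 / 2) / 2 ^ α.1 = corner α i + side α / 2 := by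
      rw [corner, side, add_div]; ring
    rw [h4] at h1
    obtain ⟨h5, h6⟩ := abs_lt.1 (h1.trans_le h3)
    have hs := side_pos α
    rcases le_or_gt (p.1 i) (corner α i) with hl | hl
    · exact ⟨-1, by norm_num, by push_cast; linarith, by push_cast; linarith⟩
    · rcases lt_or_ge (p.1 i) (corner α i + side α) with hu | hu
      · exact ⟨0, by norm_num, by push_cast; linarith, by push_cast; linarith⟩
      · exact ⟨1, by norm_num, by push_cast; linarith, by push_cast; linarith⟩
  choose e he1 he2 using hcoord
  exact hp e he1 ⟨he2, by rw [zero_add]; exact hpα.2⟩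

/-- Integrability with respect to the weight implies integrability near the boundary. -/
theorem IsA1Loc.integrableOn_spaceCube_of_mul (h : IsA1Loc γ C) {u : Space n → ℝ}
    (hu : Measurable u) (hγ : ∫⁻ p in upperHalf n, ‖γ p * u p‖ₑ < ∞) (a : Fin n → ℝ) :
    IntegrableOn u (spaceCube a 0 1) := by
  refine ⟨hu.aestronglyMeasurable, ?_⟩
  set A := ⨍ q in spaceCube a 0 1, γ q
  have hA : 0 < A := h.1.average_pos a 0 one_pos
  have hsub : spaceCube a 0 1 ⊆ upperHalf n := fun p hp => hp.2.1
  calc ∫⁻ p in spaceCube a 0 1, ‖u p‖ₑ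
      ≤ ∫⁻ p in spaceCube a 0 1, ENNReal.ofReal (max C 1 / A) * ‖γ p * u p‖ₑ := by
        refine setLIntegral_mono_ae' (isOpen_spaceCube a 0 1).measurableSet ?_
        filter_upwards [h.ae_average_le a 0 one_pos le_rfl, h.1.2] with p hp hp0 hpS
        have h1 : 1 ≤ max C 1 / A * γ p := by
          rw [div_mul_eq_mul_div, le_div_iff₀ hA, one_mul]; exact hp hpS
        rw [enorm_mul, ← mul_assoc, Real.enorm_eq_ofReal hp0.le,
          ← ENNReal.ofReal_mul (div_nonneg (le_max_of_le_right zero_le_one) hA.le)]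
        exact le_mul_of_one_le_left zero_le (ENNReal.one_le_ofReal.2 h1)
    _ = ENNReal.ofReal (max C 1 / A) * ∫⁻ p in spaceCube a 0 1, ‖γ p * u p‖ₑ :=
        lintegral_const_mul' _ _ ENNReal.ofReal_ne_top
    _ ≤ ENNReal.ofReal (max C 1 / A) * ∫⁻ p in upperHalf n, ‖γ p * u p‖ₑ := by
        gcongr
    _ < ∞ := ENNReal.mul_lt_top ENNReal.ofReal_lt_top hγ

/-- The A₁ condition only concerns sides at most 1, so a larger base is covered by finitely many
unit cubes, by compactness. -/
theorem IsA1Loc.integrableOn_prod_Ioo_of_mul (h : IsA1Loc γ C) {u : Space n → ℝ}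
    (hu : Measurable u) (hγ : ∫⁻ p in upperHalf n, ‖γ p * u p‖ₑ < ∞) (a : Fin n → ℝ) (ρ : ℝ)
    {r : ℝ} (hr : r ≤ 1) : IntegrableOn u (cube a ρ ×ˢ Ioo 0 r) := by
  let K : Set (Fin n → ℝ) := Set.pi univ fun i => Icc (a i) (a i + ρ)
  have hK : IsCompact K := isCompact_univ_pi fun i => isCompact_Icc
  have key : IntegrableOn u (K ×ˢ Ioo 0 1) := by
    refine hK.induction_on (p := fun s => IntegrableOn u (s ×ˢ Ioo (0 : ℝ) 1) volume) (by simp)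
      (fun s t hst ht => ht.mono_set (prod_mono hst subset_rfl))
      (fun s t hs ht => by rw [union_prod]; exact hs.union ht) fun x _ => ?_
    refine ⟨cube (fun i => x i - 1 / 2) 1, mem_nhdsWithin_of_mem_nhds
      ((isOpen_cube _ _).mem_nhds fun i => ⟨by linarith, by linarith⟩), ?_⟩
    have := h.integrableOn_spaceCube_of_mul hu hγ (fun i => x i - 1 / 2)
    rwa [spaceCube, zero_add] at this
  refine key.mono_set (prod_mono ?_ (Ioo_subset_Ioo_right hr))
  rw [cube_eq_pi]
  exact Set.pi_mono fun i _ => Ioo_subset_Icc_self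

end Weights

/-! ### Summation over the tilings -/

/-- A geometric series read from its largest term: by induction, the terms before the last sum to at
most twice half of the last one. -/
theorem sum_le_two_mul_of_doubling {S : Finset ℕ} {a : ℕ → ℝ≥0∞} {M : ℝ≥0∞}
    (hd : ∀ s ∈ S, ∀ t ∈ S, s < t → 2 * a s ≤ a t) (hM : ∀ s ∈ S, a s ≤ M) :
    ∑ s ∈ S, a s ≤ 2 * M := by
  induction S using Finset.induction_on_max generalizing M with
  | empty => simp
  | insert t S hlt ih =>
    rw [Finset.sum_insert fun h => lt_irrefl _ (hlt t h)]
    have h1 : ∑ s ∈ S, a s ≤ 2 * (a t / 2) := by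
      refine ih (fun s hs u hu => hd s (Finset.mem_insert_of_mem hs) u
        (Finset.mem_insert_of_mem hu)) fun s hs => ?_
      rw [ENNReal.le_div_iff_mul_le (by simp) (by simp), mul_comm]
      exact hd s (Finset.mem_insert_of_mem hs) t (Finset.mem_insert_self _ _) (hlt s hs)
    rw [ENNReal.mul_div_cancel (by simp) (by simp)] at h1
    have h2 := hM t (Finset.mem_insert_self _ _)
    rw [two_mul]
    exact add_le_add h2 (h1.trans h2)

section Summation

variable {n : ℕ} {k : ℕ}

/-- The box `Q̃_α × (0, r(Q_α))`. -/
def enlargedBox (k : ℕ) (α : DyadicIndex n) : Set (Space n) :=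
  enlargedCube k α ×ˢ Ioo 0 (side α)

/-- The strip `ℝⁿ × (0, 2^{-m})`. -/
def strip (n m : ℕ) : Set (Space n) := univ ×ˢ Ioo 0 ((2 : ℝ) ^ m)⁻¹

theorem measurableSet_strip (n m : ℕ) : MeasurableSet (strip n m) :=
  MeasurableSet.univ.prod measurableSet_Ioo

theorem strip_subset_upperHalf (n m : ℕ) : strip n m ⊆ upperHalf n :=
  prod_Ioo_subset_upperHalf _ _

theorem enlargedCube_eq_cube (k : ℕ) (α : DyadicIndex n) :
    enlargedCube k α = cube (fun i => ((α.2 i : ℝ) + 1 / 2) / 2 ^ α.1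
      - (1 + ((2 : ℝ) ^ k)⁻¹) * side α / 2) ((1 + ((2 : ℝ) ^ k)⁻¹) * side α) := by
  ext x
  simp only [enlargedCube, cube, mem_ofPred_eq, abs_lt]
  refine forall_congr' fun i => ⟨fun h => ?_, fun h => ?_⟩ <;> constructor <;> linarith [h.1, h.2]

theorem measurableSet_enlargedBox (k : ℕ) (α : DyadicIndex n) :
    MeasurableSet (enlargedBox k α) := by
  rw [enlargedBox, enlargedCube_eq_cube]
  exact (measurableSet_cube _ _).prod measurableSet_Ioo

theorem enlargedBox_subset_upperHalf (k : ℕ) (α : DyadicIndex n) :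
    enlargedBox k α ⊆ upperHalf n := prod_Ioo_subset_upperHalf _ _

theorem enlargement_le (k : ℕ) (α : DyadicIndex n) :
    0 < (1 + ((2 : ℝ) ^ k)⁻¹) * side α ∧ (1 + ((2 : ℝ) ^ k)⁻¹) * side α ≤ 2 * side α := by
  have h1 := side_pos α
  have h2 := half_enlargement_le k
  constructor
  · positivity
  · nlinarith

/-- A sum over a family of bounded overlap. -/
theorem tsum_indicator_enlargedBox_le {B : Set (DyadicIndex n)}
    (hB : ∀ α ∈ B, ¬ enlargedCube k α ⊆ ⋃ β ∈ B \ {α}, enlargedCube k β)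
    {w : DyadicIndex n → ℝ≥0∞} {p : Space n} {m : ℝ≥0∞}
    (hm : ∀ α ∈ B, p ∈ enlargedBox k α → w α ≤ m) :
    ∑' α : B, (enlargedBox k (α : DyadicIndex n)).indicator (fun _ => w α) p
      ≤ overlapBound n k * m := by
  classical
  rw [ENNReal.tsum_eq_iSup_sum]
  refine iSup_le fun F => ?_
  have hcard : ((F.filter fun α : B => p ∈ enlargedBox k (α : DyadicIndex n)).card)
      ≤ overlapBound n k := by
    rw [← Finset.card_image_of_injective _ Subtype.val_injective]
    refine card_le_overlapBound hB (x := p.1) (fun α hα => ?_) fun α hα => ?_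
    · obtain ⟨a, -, rfl⟩ := Finset.mem_image.1 hα
      exact a.2
    · obtain ⟨a, ha, rfl⟩ := Finset.mem_image.1 hα
      exact (Finset.mem_filter.1 ha).2.1
  calc ∑ α ∈ F, (enlargedBox k (α : DyadicIndex n)).indicator (fun _ => w α) p
      = ∑ α ∈ F.filter (fun α : B => p ∈ enlargedBox k (α : DyadicIndex n)), w α := by
        rw [Finset.sum_filter]
        rfl
    _ ≤ ∑ _α ∈ F.filter (fun α : B => p ∈ enlargedBox k (α : DyadicIndex n)), m :=
        Finset.sum_le_sum fun α hα => hm α α.2 (Finset.mem_filter.1 hα).2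
    _ ≤ overlapBound n k * m := by
        rw [Finset.sum_const, nsmul_eq_mul]
        gcongr

variable {w : DyadicIndex n → ℝ} {D T : ℝ} {l : ℕ → ℕ}

/-- The total weight of the boxes containing a given point: boxes of minimal size lie in thin
strips, and the weights of the others form a geometric progression. -/
theorem IsSlowlyVarying.tsum_tsum_indicator_le (hw : IsSlowlyVarying w D) (hT : 2 * D ^ 3 ≤ T)
    (hl : StrictMono l) {B : ℕ → Set (DyadicIndex n)}
    (hB : ∀ s, IsReducedIndexSet k (stoppingTiling w T l s) (B s)) {p : Space n} {Γ : ℝ≥0∞}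
    (hΓ : ∀ α, p ∈ enlargedBox k α → ENNReal.ofReal (w α) ≤ Γ) :
    ∑' s, ∑' α : B (s + 1),
        (enlargedBox k (α : DyadicIndex n)).indicator (fun _ => ENNReal.ofReal (w α)) p
      ≤ (∑' s, (strip n (l (s + 1))).indicator (fun _ => overlapBound n k * Γ) p)
        + overlapBound n k * (2 * Γ) := by
  classical
  -- `m s` is the largest weight of a box of `B (s + 1)` over `p`. Bounded overlap reduces the inner
  -- sum to a multiple of it.
  let m : ℕ → ℝ≥0∞ := fun s =>
    ⨆ α ∈ {α | α ∈ B (s + 1) ∧ p ∈ enlargedBox k α}, ENNReal.ofReal (w α)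
  let P : ℕ → Prop := fun s => p ∈ strip n (l (s + 1))
  have hmΓ : ∀ s, m s ≤ Γ := fun s => iSup₂_le fun α hα => hΓ α hα.2
  have hlevel : ∀ s, ¬ P s → ∀ α ∈ B (s + 1), p ∈ enlargedBox k α → α.1 ≠ l (s + 1) := by
    intro s hs α _ hp he
    exact hs ⟨mem_univ _, by rw [← he]; exact hp.2⟩
  -- Outside the strip every box over `p` was stopped by growth, so the nonzero `m s` double along
  -- the sequence. Indices without a box over `p` have supremum 0 and are discarded first.
  have hsum : ∑' s, (if P s then 0 else m s) ≤ 2 * Γ := by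
    rw [ENNReal.tsum_eq_iSup_sum]
    refine iSup_le fun F => ?_
    let S := F.filter fun s => ¬ P s ∧ ∃ α ∈ B (s + 1), p ∈ enlargedBox k α
    have e : ∑ s ∈ F, (if P s then 0 else m s) = ∑ s ∈ S, m s := by
      rw [Finset.sum_filter]
      refine Finset.sum_congr rfl fun s _ => ?_
      by_cases hP : P s
      · simp [hP]
      · by_cases hex : ∃ α ∈ B (s + 1), p ∈ enlargedBox k α
        · simp only [hP, hex, if_false, not_false_eq_true, and_self, if_true]
        · simp only [hP, hex, if_false, and_false]
          refine le_antisymm (iSup₂_le fun α hα => absurd ⟨α, hα⟩ hex) zero_le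
    rw [e]
    refine sum_le_two_mul_of_doubling (fun s _ t ht hst => ?_) fun s _ => hmΓ s
    obtain ⟨hPt, β, hβ, hpβ⟩ := (Finset.mem_filter.1 ht).2
    have hle : m s ≤ ENNReal.ofReal (w β) / 2 := by
      refine iSup₂_le fun α hα => ?_
      have := hw.two_mul_le (k := k) hT hl (by omega : s + 1 < t + 1) ((hB _).subset hα.1)
        ((hB _).subset hβ) (hlevel t hPt β hβ hpβ) ⟨p.1, hα.2.1, hpβ.1⟩
      rw [ENNReal.le_div_iff_mul_le (by simp) (by simp), mul_comm]
      calc 2 * ENNReal.ofReal (w α) = ENNReal.ofReal (2 * w α) := by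
            rw [ENNReal.ofReal_mul (by norm_num)]; simp
        _ ≤ _ := ENNReal.ofReal_le_ofReal this
    calc 2 * m s ≤ 2 * (ENNReal.ofReal (w β) / 2) := by gcongr
      _ = ENNReal.ofReal (w β) := ENNReal.mul_div_cancel (by simp) (by simp)
      _ ≤ m t := le_iSup₂_of_le β ⟨hβ, hpβ⟩ le_rfl
  calc _ ≤ ∑' s, (overlapBound n k : ℝ≥0∞) * m s :=
        ENNReal.tsum_le_tsum fun s => tsum_indicator_enlargedBox_le (hB (s + 1)).irredundant
          (w := fun α => ENNReal.ofReal (w α)) fun α hα hp => le_iSup₂_of_le α ⟨hα, hp⟩ le_rfl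
    _ ≤ ∑' s, ((strip n (l (s + 1))).indicator (fun _ => overlapBound n k * Γ) p
          + overlapBound n k * (if P s then 0 else m s)) := by
        refine ENNReal.tsum_le_tsum fun s => ?_
        by_cases hP : P s
        · rw [indicator_of_mem hP, if_pos hP, mul_zero, add_zero]
          gcongr
          exact hmΓ s
        · rw [indicator_of_notMem hP, if_neg hP, zero_add]
    _ = _ := by rw [ENNReal.tsum_add, ENNReal.tsum_mul_left]
    _ ≤ _ := by gcongr

/-- Levels can be chosen so that the integrals over the strips decay geometrically. -/
theorem exists_levels {H : Space n → ℝ≥0∞} (hH : ∫⁻ p in upperHalf n, H p ≠ ∞) :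
    ∃ l : ℕ → ℕ, StrictMono l ∧ l 0 = 0 ∧
      ∀ s, ∫⁻ p in strip n (l s), H p ≤ 2⁻¹ ^ s * ∫⁻ p in upperHalf n, H p := by
  set M := ∫⁻ p in upperHalf n, H p
  have hle : ∀ m, ∫⁻ p in strip n m, H p ≤ M := fun m => lintegral_mono_set (strip_subset_upperHalf n m)
  have hlim : Tendsto (fun m => ∫⁻ p in strip n m, H p) atTop (𝓝 0) := by
    have hanti : Antitone (strip n) := fun i j hij =>
      prod_mono subset_rfl (Ioo_subset_Ioo_right
        (inv_anti₀ (by positivity) (pow_le_pow_right₀ (by norm_num) hij)))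
    have hinter : ⋂ m, strip n m = ∅ := by
      rw [eq_empty_iff_forall_notMem]
      intro p hp
      have h0 : 0 < p.2 := (mem_iInter.1 hp 0).2.1
      obtain ⟨m, hm⟩ := exists_pow_lt_of_lt_one h0 (by norm_num : (2 : ℝ)⁻¹ < 1)
      have := (mem_iInter.1 hp m).2.2
      rw [inv_pow] at hm
      exact lt_irrefl _ (this.trans hm)
    have := tendsto_measure_iInter_atTop (μ := volume.withDensity H)
      (fun m => (measurableSet_strip n m).nullMeasurableSet) hanti ⟨0, by
        rw [withDensity_apply _ (measurableSet_strip n 0)]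
        exact ((hle 0).trans_lt hH.lt_top).ne⟩
    rw [hinter, measure_empty] at this
    refine this.congr fun m => ?_
    rw [Function.comp_apply, withDensity_apply _ (measurableSet_strip n m)]
  rcases eq_or_ne M 0 with h0 | h0
  · exact ⟨id, strictMono_id, rfl, fun s => (hle _).trans (by rw [h0]; exact zero_le)⟩
  · have hev : ∀ s : ℕ, ∀ᶠ m in atTop, ∫⁻ p in strip n (m + 1), H p ≤ 2⁻¹ ^ (s + 1) * M := by
      intro s
      have hpos : 0 < 2⁻¹ ^ (s + 1) * M :=
        ENNReal.mul_pos (pow_ne_zero _ (by simp)) h0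
      exact (((tendsto_add_atTop_iff_nat 1).2 hlim).eventually (gt_mem_nhds hpos)).mono
        fun _ h => h.le
    obtain ⟨θ, hθ, hθM⟩ := extraction_forall_of_eventually hev
    -- The shift by 1 keeps the later levels strictly above `l 0 = 0`. At level 0 the bound is
    -- trivial.
    refine ⟨fun s => Nat.casesOn s 0 fun i => θ i + 1, ?_, rfl, ?_⟩
    · refine strictMono_nat_of_lt_succ fun s => ?_
      cases s with
      | zero => exact Nat.succ_pos _
      | succ s => exact Nat.succ_lt_succ (hθ s.lt_succ_self)
    · intro s
      cases s with
      | zero => simpa using hle 0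
      | succ s => exact hθM s

end Summation

/-! ### The trace theorem -/

section TraceTheorem

variable {n : ℕ} {k : ℕ} {γ f F : Space n → ℝ} {G : Fin n → Space n → ℝ} {C : ℝ}

theorem IsTrace.congr {φ : (Fin n → ℝ) → ℝ} {f' : Space n → ℝ} (h : IsTrace f φ)
    (hf : f =ᵐ[volume.restrict (upperHalf n)] f') : IsTrace f' φ := by
  obtain ⟨h1, g, hg, h2⟩ := h
  exact ⟨h1, g, hg.trans hf, h2⟩

theorem hasWeakDeriv_weakDeriv {Ω : Set (Space n)} {v : Space n} (h : ∃ g, HasWeakDeriv Ω v f g) :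
    HasWeakDeriv Ω v f (weakDeriv Ω v f) := by
  rw [weakDeriv, dif_pos h]
  exact h.choose_spec

/-- This moves the mean weight inside the integral, where it is almost everywhere at most
`comparisonConstant n C * γ p`. -/
theorem ofReal_meanWeight_mul_lintegral_le (hγ : IsA1Loc γ C) {α : DyadicIndex n}
    {E : Set (Space n)} (hE : MeasurableSet E) (hEα : E ⊆ enlargedBox k α) (u : Space n → ℝ) :
    ENNReal.ofReal (meanWeight γ α) * ∫⁻ p in E, ‖u p‖ₑ
      ≤ ENNReal.ofReal (comparisonConstant n C) * ∫⁻ p in E, ‖γ p * u p‖ₑ := by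
  have hD : 0 ≤ comparisonConstant n C := zero_le_one.trans (le_comparisonConstant n C).1
  rw [← lintegral_const_mul' _ _ ENNReal.ofReal_ne_top,
    ← lintegral_const_mul' _ _ ENNReal.ofReal_ne_top]
  refine setLIntegral_mono_ae' hE ?_
  filter_upwards [hγ.ae_meanWeight_le k, hγ.1.2] with p hp hp0 hpE
  rw [enorm_mul, ← mul_assoc, Real.enorm_eq_ofReal hp0.le, ← ENNReal.ofReal_mul hD]
  gcongr
  exact hp α (hEα hpE)

/-- The unit boxes are disjoint, so the local trace estimates add up without any overlap constant.
-/
theorem IsA1Loc.unitCubeSum_le (hγ : IsA1Loc γ C) {φ : (Fin n → ℝ) → ℝ} (hφ : IsTrace f φ)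
    (hT : HasWeakDeriv (upperHalf n) (dirT n) f F) (hfm : Measurable f) (hFm : Measurable F)
    (hf : ∫⁻ p in upperHalf n, ‖γ p * f p‖ₑ < ∞) (hF : ∫⁻ p in upperHalf n, ‖γ p * F p‖ₑ < ∞) :
    unitCubeSum γ φ ≤ ENNReal.ofReal (comparisonConstant n C) *
      ((∫⁻ p in upperHalf n, ‖γ p * f p‖ₑ) + ∫⁻ p in upperHalf n, ‖γ p * F p‖ₑ) := by
  let V : (Fin n → ℤ) → Set (Space n) := fun m => dyadicCube (0, m) ×ˢ Ioo 0 1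
  have hs : ∀ m : Fin n → ℤ, side ((0, m) : DyadicIndex n) = 1 := fun m => by simp [side]
  have hVm : ∀ m, MeasurableSet (V m) := fun m => by
    simp only [V, dyadicCube_eq_cube]
    exact (measurableSet_cube _ _).prod measurableSet_Ioo
  have hVd : Pairwise (Function.onFun Disjoint V) := by
    intro m m' hne
    rw [Function.onFun, Set.disjoint_iff_inter_eq_empty, ← Set.not_nonempty_iff_eq_empty]
    rintro ⟨p, hp, hp'⟩
    have := ancestor_eq_of_inter (α := (0, m)) (β := (0, m')) ⟨p.1, hp.1, hp'.1⟩ le_rfl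
    exact hne (congrArg Prod.snd (this.symm.trans (ancestor_self ((0, m') : DyadicIndex n))))
  have hVsub : ∀ m, V m ⊆ enlargedBox 0 (0, m) := fun m =>
    prod_mono (dyadicCube_subset_enlargedCube 0 _) (by rw [hs])
  have hsum : ∀ u : Space n → ℝ, ∑' m, ∫⁻ p in V m, ‖γ p * u p‖ₑ
      ≤ ∫⁻ p in upperHalf n, ‖γ p * u p‖ₑ := by
    intro u
    rw [← lintegral_iUnion hVm hVd]
    exact lintegral_mono_set (iUnion_subset fun m => prod_Ioo_subset_upperHalf _ _)
  calc unitCubeSum γ φ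
      ≤ ∑' m, ENNReal.ofReal (comparisonConstant n C) *
          ((∫⁻ p in V m, ‖γ p * f p‖ₑ) + ∫⁻ p in V m, ‖γ p * F p‖ₑ) := by
        refine ENNReal.tsum_le_tsum fun m => ?_
        have hi : ∀ u : Space n → ℝ, Measurable u → ∫⁻ p in upperHalf n, ‖γ p * u p‖ₑ < ∞ →
            IntegrableOn u (cube (corner (0, m)) (side ((0, m) : DyadicIndex n)) ×ˢ Ioo 0 1) :=
          fun u hu huγ => hγ.integrableOn_prod_Ioo_of_mul hu huγ _ _ le_rfl
        have h1 := hφ.lintegral_le (side_pos _) (hT.mono (prod_Ioo_subset_upperHalf _ 1)) hfm hFm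
          (hi f hfm hf) (hi F hFm hF)
        rw [← dyadicCube_eq_cube] at h1
        calc _ ≤ ENNReal.ofReal (meanWeight γ (0, m)) *
              ((∫⁻ p in V m, ‖f p‖ₑ) + ∫⁻ p in V m, ‖F p‖ₑ) := by gcongr
          _ ≤ _ := by
            rw [mul_add, mul_add]
            exact add_le_add
              (ofReal_meanWeight_mul_lintegral_le hγ (hVm m) (hVsub m) f)
              (ofReal_meanWeight_mul_lintegral_le hγ (hVm m) (hVsub m) F)
    _ ≤ _ := by
        rw [ENNReal.tsum_mul_left, ENNReal.tsum_add]
        gcongr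
        · exact hsum f
        · exact hsum F

/-- Summation and integration are exchanged, so that the pointwise bound on the total weight of the
boxes can be integrated against the gradient. The mass in the thin strips is summed using the choice
of levels. -/
theorem IsA1Loc.oscillationSum_le (hγ : IsA1Loc γ C) {φ : (Fin n → ℝ) → ℝ} (hφ : IsTrace f φ)
    (hX : ∀ i, HasWeakDeriv (upperHalf n) (dirX i) f (G i))
    (hT : HasWeakDeriv (upperHalf n) (dirT n) f F) (hfm : Measurable f) (hFm : Measurable F)
    (hGm : ∀ i, Measurable (G i)) (hf : ∫⁻ p in upperHalf n, ‖γ p * f p‖ₑ < ∞)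
    (hF : ∫⁻ p in upperHalf n, ‖γ p * F p‖ₑ < ∞)
    (hG : ∀ i, ∫⁻ p in upperHalf n, ‖γ p * G i p‖ₑ < ∞)
    {l : ℕ → ℕ} (hl : StrictMono l) {M : ℝ≥0∞}
    (hM : ∫⁻ p in upperHalf n, ‖γ p‖ₑ * (∑ i, ‖G i p‖ₑ + ‖F p‖ₑ) ≤ M)
    (hlM : ∀ s, ∫⁻ p in strip n (l s), ‖γ p‖ₑ * (∑ i, ‖G i p‖ₑ + ‖F p‖ₑ) ≤ 2⁻¹ ^ s * M)
    {T : ℝ} (hTD : 2 * comparisonConstant n C ^ 3 ≤ T) {B : ℕ → Set (DyadicIndex n)}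
    (hB : ∀ s, IsReducedIndexSet k (stoppingTiling (meanWeight γ) T l s) (B s)) :
    oscillationSum γ k B φ ≤
      2 ^ (n + 1) * (4 * (overlapBound n k * (ENNReal.ofReal (comparisonConstant n C) * M))) := by
  set D := comparisonConstant n C
  have hD : 0 ≤ D := zero_le_one.trans (le_comparisonConstant n C).1
  set N : ℝ≥0∞ := ((overlapBound n k : ℕ) : ℝ≥0∞)
  let H : Space n → ℝ≥0∞ := fun p => ∑ i, ‖G i p‖ₑ + ‖F p‖ₑ
  have hHm : Measurable H := by fun_prop
  have hγm : AEMeasurable γ (volume.restrict (upperHalf n)) :=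
    hγ.1.1.aestronglyMeasurable.aemeasurable.restrict
  let W : DyadicIndex n → Space n → ℝ≥0∞ := fun α =>
    (enlargedBox k α).indicator fun _ => ENNReal.ofReal (meanWeight γ α)
  have hWm : ∀ α, Measurable (W α) := fun α =>
    measurable_const.indicator (measurableSet_enlargedBox k α)
  have hterm : ∀ α : DyadicIndex n, ENNReal.ofReal (meanWeight γ α) *
      ∫⁻ x in enlargedCube k α, ‖(⨍ y in enlargedCube k α, φ y) - φ x‖ₑ
        ≤ 2 ^ (n + 1) * ∫⁻ p in upperHalf n, W α p * H p := by
    intro α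
    have hi : ∀ u : Space n → ℝ, Measurable u → ∫⁻ p in upperHalf n, ‖γ p * u p‖ₑ < ∞ →
        ∀ a ρ, IntegrableOn u (cube a ρ ×ˢ Ioo 0 (side α)) :=
      fun u hu huγ a ρ => hγ.integrableOn_prod_Ioo_of_mul hu huγ a ρ (side_le_one α)
    have h1 : ∫⁻ x in enlargedCube k α, ‖(⨍ y in enlargedCube k α, φ y) - φ x‖ₑ
        ≤ 2 ^ (n + 1) * ∫⁻ p in enlargedBox k α, H p := by
      rw [enlargedBox, enlargedCube_eq_cube]
      exact hφ.lintegral_average_sub_le (enlargement_le k α).1 (side_pos α) (enlargement_le k α).2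
        (fun i => (hX i).mono (prod_Ioo_subset_upperHalf _ _))
        (hT.mono (prod_Ioo_subset_upperHalf _ _)) hfm hFm hGm (hi f hfm hf _ _) (hi F hFm hF _ _)
        fun i => hi (G i) (hGm i) (hG i) _ _
    have h2 : ∫⁻ p in upperHalf n, W α p * H p
        = ENNReal.ofReal (meanWeight γ α) * ∫⁻ p in enlargedBox k α, H p := by
      rw [← lintegral_const_mul' _ _ ENNReal.ofReal_ne_top,
        ← inter_eq_left.2 (enlargedBox_subset_upperHalf k α),
        ← Measure.restrict_restrict (measurableSet_enlargedBox k α),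
        ← lintegral_indicator (measurableSet_enlargedBox k α)]
      congr 1; ext p
      by_cases hp : p ∈ enlargedBox k α <;> simp [W, hp]
    rw [h2, mul_left_comm]
    gcongr
  have hpt : ∀ᵐ p ∂volume.restrict (upperHalf n), ∑' s, ∑' α : B (s + 1), W α p ≤
      (∑' s, (strip n (l (s + 1))).indicator (fun p => N * (ENNReal.ofReal D * ‖γ p‖ₑ)) p)
        + N * (2 * (ENNReal.ofReal D * ‖γ p‖ₑ)) := by
    refine ae_restrict_of_ae ?_
    filter_upwards [hγ.ae_meanWeight_le k, hγ.1.2] with p hp hp0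
    refine hγ.isSlowlyVarying.tsum_tsum_indicator_le hTD hl hB
      (Γ := ENNReal.ofReal D * ‖γ p‖ₑ) fun α hα => ?_
    rw [Real.enorm_eq_ofReal hp0.le, ← ENNReal.ofReal_mul hD]
    exact ENNReal.ofReal_le_ofReal (hp α hα)
  calc oscillationSum γ k B φ
      ≤ ∑' s, ∑' α : B (s + 1), 2 ^ (n + 1) * ∫⁻ p in upperHalf n, W α p * H p :=
        ENNReal.tsum_le_tsum fun s => ENNReal.tsum_le_tsum fun α => hterm α
    _ = 2 ^ (n + 1) * ∫⁻ p in upperHalf n, (∑' s, ∑' α : B (s + 1), W α p) * H p := by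
        simp only [ENNReal.tsum_mul_left]
        congr 1
        simp only [← ENNReal.tsum_mul_right]
        have hWH : ∀ α, Measurable fun p => W α p * H p := fun α => (hWm α).mul hHm
        rw [lintegral_tsum fun s => (Measurable.tsum fun α : B (s + 1) =>
          hWH α).aemeasurable]
        congr 1; ext s
        rw [lintegral_tsum fun α : B (s + 1) => (hWH α).aemeasurable]
    _ ≤ 2 ^ (n + 1) * ∫⁻ p in upperHalf n,
          ((∑' s, (strip n (l (s + 1))).indicator
              (fun p => N * ENNReal.ofReal D * (‖γ p‖ₑ * H p)) p)
            + N * ENNReal.ofReal D * 2 * (‖γ p‖ₑ * H p)) := by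
        refine mul_le_mul_right (lintegral_mono_ae ?_) _
        filter_upwards [hpt] with p hp
        refine (mul_le_mul_left hp _).trans_eq ?_
        rw [add_mul, ← ENNReal.tsum_mul_right]
        congr 1
        · congr 1; ext s
          by_cases hp : p ∈ strip n (l (s + 1))
          · rw [indicator_of_mem hp, indicator_of_mem hp]; ring
          · rw [indicator_of_notMem hp, indicator_of_notMem hp, zero_mul]
        · ring
    _ = 2 ^ (n + 1) * ((∑' s, N * ENNReal.ofReal D * ∫⁻ p in strip n (l (s + 1)), ‖γ p‖ₑ * H p)
          + N * ENNReal.ofReal D * 2 * ∫⁻ p in upperHalf n, ‖γ p‖ₑ * H p) := by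
        have hm : AEMeasurable (fun p => ‖γ p‖ₑ * H p) (volume.restrict (upperHalf n)) :=
          hγm.enorm.mul hHm.aemeasurable
        have hNt : N ≠ ∞ := ENNReal.natCast_ne_top _
        have hND : N * ENNReal.ofReal D ≠ ∞ := ENNReal.mul_ne_top hNt ENNReal.ofReal_ne_top
        rw [lintegral_add_right' _ (hm.const_mul _),
          lintegral_const_mul' _ _ (ENNReal.mul_ne_top hND (by simp)),
          lintegral_tsum fun s => (hm.const_mul _).indicator (measurableSet_strip n _)]
        congr 3; ext s
        rw [lintegral_indicator (measurableSet_strip n _),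
          Measure.restrict_restrict (measurableSet_strip n _),
          inter_eq_left.2 (strip_subset_upperHalf n _), lintegral_const_mul' _ _ hND]
    _ ≤ 2 ^ (n + 1) * ((∑' s : ℕ, N * ENNReal.ofReal D * (2⁻¹ ^ (s + 1) * M))
          + N * ENNReal.ofReal D * 2 * M) := by
        gcongr
        exact hlM _
    -- The strips contribute `∑ 2⁻¹ ^ (s + 1) = 1` and the growing weights contribute 2. The final
    -- constant rounds 3 up to 4.
    _ = 2 ^ (n + 1) * (3 * (N * (ENNReal.ofReal D * M))) := by
        rw [ENNReal.tsum_mul_left, ENNReal.tsum_mul_right, ENNReal.tsum_geometric_add_one]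
        have : (2⁻¹ : ℝ≥0∞) * (1 - 2⁻¹)⁻¹ = 1 := by
          rw [ENNReal.one_sub_inv_two, inv_inv, ENNReal.inv_mul_cancel (by simp) (by simp)]
        rw [this]
        ring
    _ ≤ _ := by gcongr; norm_num

end TraceTheorem

theorem theorem4p1 (n : ℕ) (hn : 1 ≤ n) (Cγ : ℝ) :
    ∃ c₁ c₂ : ℝ, 1 ≤ c₁ ∧ 1 ≤ c₂ ∧
      ∀ k : ℕ, ∃ K : ℝ, 0 ≤ K ∧
        ∀ γ : Space n → ℝ, IsA1Loc γ Cγ →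
          ∀ f : Space n → ℝ, MemSobolev (upperHalf n) γ f →
            (∃ φ : (Fin n → ℝ) → ℝ, IsTrace f φ) ∧
            ∃ A : ℕ → Set (DyadicIndex n), IsAdmissible γ k c₁ c₂ A ∧
              (∀ s, ∃ B, IsReducedIndexSet k (A s) B) ∧
              ∀ B : ℕ → Set (DyadicIndex n), (∀ s, IsReducedIndexSet k (A s) (B s)) →
                ∀ φ : (Fin n → ℝ) → ℝ, IsTrace f φ →
                  unitCubeSum γ φ + oscillationSum γ k B φ
                    ≤ ENNReal.ofReal K * sobolevNorm (upperHalf n) γ f := by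
  set D := comparisonConstant n Cγ with hDdef
  have hD1 : 1 ≤ D := (le_comparisonConstant n Cγ).1
  have hD0 : 0 ≤ D := zero_le_one.trans hD1
  have hD3 : 1 ≤ D ^ 3 := one_le_pow₀ hD1
  -- These are the admissibility constants for `T = 2 * D ^ 3`. They do not involve the enlargement
  -- factor, which enters only the final constant, through `overlapBound`.
  refine ⟨D ^ 2, D * (2 * D ^ 3), one_le_pow₀ hD1,
    one_le_mul_of_one_le_of_one_le hD1 (by linarith), fun k => ?_⟩
  refine ⟨D + 2 ^ (n + 1) * (4 * (overlapBound n k * D)), by positivity, fun γ hγ f hf => ?_⟩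
  set Ω := upperHalf n with hΩ
  set S := sobolevNorm Ω γ f with hS
  have hT₀ := hasWeakDeriv_weakDeriv hf.exists_derivT
  have hX₀ := fun i => hasWeakDeriv_weakDeriv (hf.exists_derivX i)
  have mf := hf.locallyIntegrable.aestronglyMeasurable
  have mT := hT₀.1.aestronglyMeasurable
  have mX := fun i => (hX₀ i).1.aestronglyMeasurable
  -- Measurable representatives are used because the slice arguments evaluate the functions on null
  -- sets. Weak derivatives, weighted norms and traces are unaffected.
  let f' : Space n → ℝ := mf.mk f
  let F : Space n → ℝ := mT.mk _
  let G : Fin n → Space n → ℝ := fun i => (mX i).mk _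
  have hfm : Measurable f' := mf.stronglyMeasurable_mk.measurable
  have hFm : Measurable F := mT.stronglyMeasurable_mk.measurable
  have hGm : ∀ i, Measurable (G i) := fun i => (mX i).stronglyMeasurable_mk.measurable
  have hT : HasWeakDeriv Ω (dirT n) f' F := hT₀.congr mf.ae_eq_mk mT.ae_eq_mk
  have hX : ∀ i, HasWeakDeriv Ω (dirX i) f' (G i) := fun i =>
    (hX₀ i).congr mf.ae_eq_mk (mX i).ae_eq_mk
  have hcongr : ∀ {u u' : Space n → ℝ}, u =ᵐ[volume.restrict Ω] u' →
      ∫⁻ p in Ω, ‖γ p * u p‖ₑ = ∫⁻ p in Ω, ‖γ p * u' p‖ₑ := fun h =>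
    lintegral_congr_ae (h.mono fun p hp => by simp only [hp])
  have hSeq : S = (∫⁻ p in Ω, ‖γ p * f' p‖ₑ) + (∑ i, ∫⁻ p in Ω, ‖γ p * G i p‖ₑ)
      + ∫⁻ p in Ω, ‖γ p * F p‖ₑ := by
    rw [hS, sobolevNorm, hcongr mf.ae_eq_mk, hcongr mT.ae_eq_mk,
      Finset.sum_congr rfl fun i _ => hcongr (mX i).ae_eq_mk]
  have hSt : S < ∞ := hf.norm_lt_top
  have hf1 : ∫⁻ p in Ω, ‖γ p * f' p‖ₑ < ∞ :=
    (le_self_add.trans (le_self_add.trans_eq hSeq.symm)).trans_lt hSt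
  have hF1 : ∫⁻ p in Ω, ‖γ p * F p‖ₑ < ∞ := (le_add_self.trans_eq hSeq.symm).trans_lt hSt
  have hG1 : ∀ i, ∫⁻ p in Ω, ‖γ p * G i p‖ₑ < ∞ := fun i =>
    ((Finset.single_le_sum (f := fun i => ∫⁻ p in Ω, ‖γ p * G i p‖ₑ) (fun _ _ => zero_le)
      (Finset.mem_univ i)).trans
      (le_add_self.trans (le_self_add.trans_eq hSeq.symm))).trans_lt hSt
  have hfS : (∫⁻ p in Ω, ‖γ p * f' p‖ₑ) + ∫⁻ p in Ω, ‖γ p * F p‖ₑ ≤ S := by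
    rw [hSeq]; gcongr; exact le_self_add
  have hγm : AEMeasurable γ (volume.restrict Ω) :=
    hγ.1.1.aestronglyMeasurable.aemeasurable.restrict
  set M := ∫⁻ p in Ω, ‖γ p‖ₑ * (∑ i, ‖G i p‖ₑ + ‖F p‖ₑ) with hMdef
  have hMS : M ≤ S := by
    have e : M = (∑ i, ∫⁻ p in Ω, ‖γ p * G i p‖ₑ) + ∫⁻ p in Ω, ‖γ p * F p‖ₑ := by
      simp only [hMdef, mul_add, Finset.mul_sum, ← enorm_mul]
      have mF : AEMeasurable (fun p => ‖γ p * F p‖ₑ) (volume.restrict Ω) :=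
        (hγm.mul hFm.aemeasurable).enorm
      have mG : ∀ i, AEMeasurable (fun p => ‖γ p * G i p‖ₑ) (volume.restrict Ω) := fun i =>
        (hγm.mul (hGm i).aemeasurable).enorm
      rw [lintegral_add_right' _ mF, lintegral_finsetSum' _ fun i _ => mG i]
    rw [e, hSeq]; gcongr; exact le_add_self
  -- In this construction `f` influences the tilings only through the levels `l`, which are adapted
  -- to the mass of its weighted gradient near the boundary.
  obtain ⟨l, hl, hl0, hlM⟩ := exists_levels (hMS.trans_lt hSt).ne
  refine ⟨?_, stoppingTiling (meanWeight γ) (2 * D ^ 3) l,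
    isAdmissible_stoppingTiling hγ.isSlowlyVarying le_rfl hl hl0, fun s => ?_, ?_⟩
  · obtain ⟨φ, hφ⟩ := exists_isTrace hT hfm hFm
      (fun j => hγ.integrableOn_prod_Ioo_of_mul hfm hf1 _ _ le_rfl)
      fun j => hγ.integrableOn_prod_Ioo_of_mul hFm hF1 _ _ le_rfl
    exact ⟨φ, hφ.congr mf.ae_eq_mk.symm⟩
  · exact exists_isReducedIndexSet (isTiling_maximalIndices (l := l s) fun α hα => Or.inl hα)
      (fun α hα => level_le_of_mem_stoppingTiling hα) k
  · intro B hB φ hφ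
    have hφ' : IsTrace f' φ := hφ.congr mf.ae_eq_mk
    have h1 := hγ.unitCubeSum_le hφ' hT hfm hFm hf1 hF1
    have h2 := hγ.oscillationSum_le hφ' hX hT hfm hFm hGm hf1 hF1 hG1 hl le_rfl hlM le_rfl hB
    calc unitCubeSum γ φ + oscillationSum γ k B φ
        ≤ ENNReal.ofReal D * S
          + 2 ^ (n + 1) * (4 * (overlapBound n k * (ENNReal.ofReal D * S))) := by
          refine add_le_add (h1.trans (by gcongr)) (h2.trans (by gcongr))
      _ = ENNReal.ofReal (D + 2 ^ (n + 1) * (4 * (overlapBound n k * D))) * S := by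
          rw [ENNReal.ofReal_add hD0 (by positivity), ENNReal.ofReal_mul (by positivity),
            ENNReal.ofReal_mul (by positivity), ENNReal.ofReal_mul (by positivity),
            ENNReal.ofReal_pow (by norm_num), ENNReal.ofReal_natCast]
          simp only [ENNReal.ofReal_ofNat]
          ring
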